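/- Let $\mathcal H$ be a finite-dimensional real Hilbert space, $\mathcal Y$ a real Banach space, $m\ge 1$, and equip $\mathcal H\times\mathbb R^m$ with the product Hilbert norm. Let $\mathcal K\subset\mathcal Y$ be a nonempty convex cone, $\mathcal K^+=\{v^*\in\mathcal Y^*:\langle v^*,y\rangle\ge 0\ \forall y\in\mathcal K\}$, and let $\mathcal C\subset\mathcal Y^*$ be a weak$^*$-compact convex set with $\operatorname{cl}^{w^*}\{t v^*: t\ge 0,\ v^*\in\mathcal C\}=\mathcal K^+$. Let $\Phi:\mathcal H\times\mathbb R^m\to\mathcal Y$ be a map and $h:\mathcal H\to\mathbb R$ a continuously differentiable convex function such that for every $v^*\in\mathcal C$ the function $\Phi^h_{v^*}(x,z):=\langle v^*,\Phi(x,z)\rangle+h(x)$ is convex on $\mathcal H\times\mathbb R^m$. Put $S(x,z):=\sup_{v^*\in\mathcal C}\Phi^h_{v^*}(x,z)$. For $\lambda>0$ and a convex function $\psi:\mathcal H\times\mathbb R^m\to\mathbb R$ let $$e_\lambda\psi(w):=\inf_{y}\Big(\psi(y)+\tfrac1{2\lambda}\|w-y\|^2\Big),\qquad \operatorname{Prox}_\lambda\psi(w):=\operatorname*{argmin}_{y}\Big(\psi(y)+\tfrac1{2\lambda}\|w-y\|^2\Big)$$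 be its Moreau envelope and its proximal point at $w$, and set $E_\lambda:=e_\lambda S$. Let $\xi:\Omega\to\mathbb R^m$ be a random vector on a probability space $(\Omega,\mathcal F,\mathbb P)$ with a continuous density $f_\xi\ge 0$ with respect to Lebesgue measure, and define $$\varphi_\lambda(x):=\mathbb P\big(\omega\in\Omega: E_\lambda(x,\xi(\omega))\le h(x)\big).$$ Let $L$ be a nonsingular real $m\times m$ matrix, $\mathbb S^{m-1}$ the Euclidean unit sphere of $\mathbb R^m$, and $\mu_\zeta$ the uniform probability measure on $\mathbb S^{m-1}$. Define $$\theta(r,v):=\frac{2\pi^{m/2}|\det L|}{\Gamma(m/2)}\,r^{m-1}f_\xi(rLv),\qquad F_\lambda(x):=\{v\in\mathbb S^{m-1}:\exists r>0,\ E_\lambda(x,rLv)=h(x)\},$$ $$\rho_\lambda(x,v):=\sup\{r>0: E_\lambda(x,rLv)\le h(x)\}\in[0,+\infty],$$ $$G_\lambda(x,v):=\begin{cases}-\theta(\rho_\lambda(x,v),v)\,\dfrac{\nabla_xE_\lambda(x,\rho_\lambda(x,v)Lv)-\nabla h(x)}{\langle\nabla_zE_\lambda(x,\rho_\lambda(x,v)Lv),Lv\rangle}&\text{if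 }v\in F_\lambda(x),\\[2mm]0&\text{if }v\in\mathbb S^{m-1}\setminus F_\lambda(x).\end{cases}$$ Let $\bar x\in\mathcal H$ satisfy $S(\bar x,0)<h(\bar x)$, and assume that $\lim_{\|z\|\to+\infty}\|z\|^{m+1}f_\xi(z)=0$. Then for every $\lambda>0$: 1. There is an open neighbourhood $U$ of $\bar x$ such that $E_\lambda(x,0)<h(x)$ for all $x\in U$, the function $\varphi_\lambda$ is continuously differentiable on $U$, and for all $x\in U$ the map $G_\lambda(x,\cdot)$ is $\mu_\zeta$-integrable and $$\nabla\varphi_\lambda(x)=\int_{\mathbb S^{m-1}}G_\lambda(x,v)\,d\mu_\zeta(v).$$ 2. For every $(x,z)\in\mathcal H\times\mathbb R^m$ there is an active vector at $(x,z)$, that is, some $v^*\in\mathcal C$ with $e_\lambda\Phi^h_{v^*}(x,z)=E_\lambda(x,z)$; and for every active vector $v^*$ at $(x,z)$ the proximal point of $\Phi^h_{v^*}$ at $(x,z)$ exists and is unique, $E_\lambda$ is differentiable at $(x,z)$, and $$\nabla E_\lambda(x,z)=\frac{(x,z)-\operatorname{Prox}_\lambda\Phi^h_{v^*}(x,z)}{\lambda}.$$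 -/

import Mathlib

open MeasureTheory Set Filter Topology

noncomputable section

namespace ChanceMoreau

/-- `ℝ^m` with its Euclidean structure. -/
abbrev Euc (m : ℕ) : Type := EuclideanSpace ℝ (Fin m)

/-- The unit sphere `𝕊^{m-1}` of `ℝ^m`. -/
abbrev Sph (m : ℕ) : Type := Metric.sphere (0 : Euc m) 1

/-- The Hilbert product `H × ℝ^m`, with `‖(x, z)‖² = ‖x‖² + ‖z‖²`. -/
abbrev Prod2 (H : Type*) (m : ℕ) : Type _ := WithLp 2 (H × Euc m)

/-- The element `(x, z)` of `H × ℝ^m`. -/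
abbrev pair {H : Type*} {m : ℕ} (x : H) (z : Euc m) : Prod2 H m := WithLp.toLp 2 (x, z)

section Cones

variable {Y : Type*} [NormedAddCommGroup Y] [NormedSpace ℝ Y]

/-- The positive dual cone `K⁺ = {v* : ⟨v*, y⟩ ≥ 0 for all y ∈ K}`. -/
def posDual (K : Set Y) : Set (WeakDual ℝ Y) := {v | ∀ y ∈ K, 0 ≤ v y}

/-- The cone `{t v* : t ≥ 0, v* ∈ C}` generated by a set `C` of functionals (a convex cone when
`C` is convex, which is the only case used). It is empty for `C = ∅`. -/
def coneOf (C : Set (WeakDual ℝ Y)) : Set (WeakDual ℝ Y) :=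
  {w | ∃ t : ℝ, 0 ≤ t ∧ ∃ v ∈ C, w = t • v}

end Cones

section Moreau

variable {X : Type*} [NormedAddCommGroup X]

/-- The Moreau envelope of `ψ` with parameter `lam`. The infimum is over a set bounded below
whenever `ψ` has an affine minorant, as a real-valued convex function on a finite-dimensional
space does. -/
def moreau (lam : ℝ) (ψ : X → ℝ) (x : X) : ℝ :=
  ⨅ y : X, (ψ y + 1 / (2 * lam) * ‖x - y‖ ^ 2)

/-- The set of minimizers that defines the proximal point of `ψ` of index `lam` at `x`. -/
def proxSet (lam : ℝ) (ψ : X → ℝ) (x : X) : Set X :=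
  {p | ∀ y : X, ψ p + 1 / (2 * lam) * ‖x - p‖ ^ 2 ≤ ψ y + 1 / (2 * lam) * ‖x - y‖ ^ 2}

end Moreau

section Scalarization

variable {H Y : Type*} [NormedAddCommGroup Y] [NormedSpace ℝ Y] {m : ℕ}

/-- The scalarization `Φ_{v*}^h (x, z) = ⟨v*, Φ(x, z)⟩ + h(x)`. -/
def scal (Φ : H → Euc m → Y) (h : H → ℝ) (v : WeakDual ℝ Y) (w : Prod2 H m) : ℝ :=
  v (Φ w.fst w.snd) + h w.fst

/-- The supremum function `S^h_Φ (x, z) = sup_{v* ∈ C} Φ_{v*}^h (x, z)`. -/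
def supFun (Φ : H → Euc m → Y) (h : H → ℝ) (C : Set (WeakDual ℝ Y)) (w : Prod2 H m) : ℝ :=
  ⨆ v : C, scal Φ h v w

/-- The Moreau envelope of the supremum function. -/
def supEnv [NormedAddCommGroup H] (Φ : H → Euc m → Y) (h : H → ℝ) (C : Set (WeakDual ℝ Y))
    (lam : ℝ) : Prod2 H m → ℝ :=
  moreau lam (supFun Φ h C)

/-- The regularized probability function
`φ_λ(x) = P(ω : (Moreau envelope of S^h_Φ)(x, ξ(ω)) ≤ h(x))`. -/
def regProb [NormedAddCommGroup H] {Ω : Type*} [MeasurableSpace Ω] (P : Measure Ω)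
    (ξ : Ω → Euc m) (Φ : H → Euc m → Y) (h : H → ℝ) (C : Set (WeakDual ℝ Y)) (lam : ℝ)
    (x : H) : ℝ :=
  P.real {ω | supEnv Φ h C lam (pair x (ξ ω)) ≤ h x}

end Scalarization

section Spherical

variable {m : ℕ}

/-- The uniform probability measure on the unit sphere `𝕊^{m-1}`. -/
def sphereUnif (m : ℕ) : Measure (Sph m) :=
  ((volume : Measure (Euc m)).toSphere univ)⁻¹ • (volume : Measure (Euc m)).toSphere

/-- The point `r L v` of `ℝ^m`. -/
def ray (L : Matrix (Fin m) (Fin m) ℝ) (r : ℝ) (v : Sph m) : Euc m :=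
  r • Matrix.toEuclideanLin L (v : Euc m)

/-- The density-like function
`θ(r, v) = (2 π^{m/2} |det L| / Γ(m/2)) r^{m-1} f(r L v)`. -/
def theta (L : Matrix (Fin m) (Fin m) ℝ) (f : Euc m → ℝ) (r : ℝ) (v : Sph m) : ℝ :=
  2 * Real.pi ^ ((m : ℝ) / 2) * |L.det| / Real.Gamma ((m : ℝ) / 2) * r ^ (m - 1) * f (ray L r v)

variable {H Y : Type*} [NormedAddCommGroup H] [NormedAddCommGroup Y] [NormedSpace ℝ Y]

/-- The finite directions `F_λ(x)`; the infinite directions are the complement. -/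
def finDir (Φ : H → Euc m → Y) (h : H → ℝ) (C : Set (WeakDual ℝ Y))
    (L : Matrix (Fin m) (Fin m) ℝ) (lam : ℝ) (x : H) : Set (Sph m) :=
  {v | ∃ r : ℝ, 0 < r ∧ supEnv Φ h C lam (pair x (ray L r v)) = h x}

/-- The radial function `ρ_λ(x, v)`, possibly `+∞`. -/
def rho (Φ : H → Euc m → Y) (h : H → ℝ) (C : Set (WeakDual ℝ Y))
    (L : Matrix (Fin m) (Fin m) ℝ) (lam : ℝ) (x : H) (v : Sph m) : EReal :=
  sSup {s : EReal | ∃ r : ℝ, 0 < r ∧ supEnv Φ h C lam (pair x (ray L r v)) ≤ h x ∧ s = (r : EReal)}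

/-- The vector `-θ(r, v) (∇_x E(x, r L v) - ∇h(x)) / ⟨∇_z E(x, r L v), L v⟩`, where `E` is the
envelope of the supremum function; partial gradients are gradients of the partial maps. -/
def gradLikeAt [InnerProductSpace ℝ H] [CompleteSpace H] (Φ : H → Euc m → Y) (h : H → ℝ)
    (C : Set (WeakDual ℝ Y)) (L : Matrix (Fin m) (Fin m) ℝ) (f : Euc m → ℝ) (lam : ℝ)
    (x : H) (v : Sph m) (r : ℝ) : H :=
  (-theta L f r v /
      inner ℝ (gradient (fun z : Euc m => supEnv Φ h C lam (pair x z)) (ray L r v))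
        (Matrix.toEuclideanLin L (v : Euc m))) •
    (gradient (fun x' : H => supEnv Φ h C lam (pair x' (ray L r v))) x - gradient h x)

open Classical in
/-- The gradient-like mapping `G_λ`. On finite directions `ρ_λ(x, v)` is a real number when the
envelope at `(x, 0)` is below `h(x)`. -/
def gradLike [InnerProductSpace ℝ H] [CompleteSpace H] (Φ : H → Euc m → Y) (h : H → ℝ)
    (C : Set (WeakDual ℝ Y)) (L : Matrix (Fin m) (Fin m) ℝ) (f : Euc m → ℝ) (lam : ℝ)
    (x : H) (v : Sph m) : H :=
  if v ∈ finDir Φ h C L lam x then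
    gradLikeAt Φ h C L f lam x v (rho Φ h C L lam x v).toReal
  else 0

end Spherical

end ChanceMoreau

end

noncomputable section

namespace ChanceMoreau

/-! ### Proximal points and Moreau envelopes of convex functions. -/

section ProximalPoint

/-! Write E for the envelope of the supremum function S. Since S is convex and finite, proximal
points exist, are unique, and the residual (w - p(w)) / λ is a Lipschitz selection of subgradients
of E. Hence E is differentiable with Lipschitz gradient. An active vector comes from Sion's minimax
theorem (`exists_active`); activity forces the proximal points of the scalarization and of S to
coincide (`proxSet_scal_of_active`), which gives the second assertion.

For the first assertion, fix x near x̄. The set {z | E(x, z) ≤ h(x)} is convex and contains a ball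
around 0, so its gauge σ(x, v) in the direction Lv is finite. It equals 1/ρ, and it is 0 exactly on
infinite directions. Unlike ρ, it is Lipschitz in x uniformly in v (`SlaterOn.levelGauge_sub_le`),
and where it is positive it is differentiated implicitly.

Polar coordinates with t = 1/r give 1 - φ(x) = ∫_v ∫_0^σ(x,v) q(t, v) dt, where q(t, v) = θ(1/t, v)
/ t². The growth condition on the density makes q continuous with q(0, v) = 0. Thus the inner
integral is differentiable even where σ = 0, with gradient 0 there; elsewhere the chain rule gives
-G. The uniform Lipschitz bound allows differentiation under the integral, and joint continuity of
the integrand's gradient gives a continuous gradient of φ. -/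

theorem moreau_eq_of_mem_proxSet {X : Type*} [NormedAddCommGroup X] {lam : ℝ} {ψ : X → ℝ}
    {w p : X} (hp : p ∈ proxSet lam ψ w) :
    moreau lam ψ w = ψ p + 1 / (2 * lam) * ‖w - p‖ ^ 2 :=
  le_antisymm (ciInf_le ⟨_, by rintro _ ⟨y, rfl⟩; exact hp y⟩ p) (le_ciInf hp)

theorem moreau_le_self {X : Type*} [NormedAddCommGroup X] {lam : ℝ} {ψ : X → ℝ} {w p : X}
    (hp : p ∈ proxSet lam ψ w) : moreau lam ψ w ≤ ψ w := by
  rw [moreau_eq_of_mem_proxSet hp]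
  simpa using hp w

variable {X : Type*} [NormedAddCommGroup X] [InnerProductSpace ℝ X] {lam : ℝ} {ψ : X → ℝ}

/-- A proximal point `p` of a convex function satisfies `(w - p) / λ ∈ ∂ψ(p)`. -/
theorem subgradient_of_mem_proxSet (hψ : ConvexOn ℝ univ ψ) (hlam : 0 < lam) {w p : X}
    (hp : p ∈ proxSet lam ψ w) (y : X) :
    ψ p + lam⁻¹ * inner ℝ (w - p) (y - p) ≤ ψ y := by
  -- Minimality of p is tested at the point a fraction t of the way to y; division by t leaves an
  -- error of order t, removed in the limit.
  have key : ∀ t ∈ Ioo (0 : ℝ) 1,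
      ψ p + lam⁻¹ * inner ℝ (w - p) (y - p) - t * (1 / (2 * lam) * ‖y - p‖ ^ 2) ≤ ψ y := by
    rintro t ⟨ht0, ht1⟩
    have h1 := hp ((1 - t) • p + t • y)
    have h2 := hψ.2 (mem_univ p) (mem_univ y) (by linarith : 0 ≤ 1 - t) ht0.le (by ring)
    have h3 : w - ((1 - t) • p + t • y) = (w - p) - t • (y - p) := by module
    have h4 : ‖w - ((1 - t) • p + t • y)‖ ^ 2
        = ‖w - p‖ ^ 2 - 2 * t * inner ℝ (w - p) (y - p) + t ^ 2 * ‖y - p‖ ^ 2 := by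
      rw [h3, norm_sub_sq_real, inner_smul_right, norm_smul, mul_pow, Real.norm_eq_abs, sq_abs]
      ring
    rw [h4] at h1
    simp only [smul_eq_mul] at h2
    have h5 : 0 ≤ t * (ψ y - (ψ p + lam⁻¹ * inner ℝ (w - p) (y - p)
        - t * (1 / (2 * lam) * ‖y - p‖ ^ 2))) := by
      have : 1 / (2 * lam) * (‖w - p‖ ^ 2 - 2 * t * inner ℝ (w - p) (y - p) + t ^ 2 * ‖y - p‖ ^ 2)
        = 1 / (2 * lam) * ‖w - p‖ ^ 2 - t * (lam⁻¹ * inner ℝ (w - p) (y - p))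
          + t * (t * (1 / (2 * lam) * ‖y - p‖ ^ 2)) := by
        field_simp
      nlinarith
    have := nonneg_of_mul_nonneg_right h5 ht0
    linarith
  have hlim : Tendsto (fun t : ℝ => ψ p + lam⁻¹ * inner ℝ (w - p) (y - p)
      - t * (1 / (2 * lam) * ‖y - p‖ ^ 2)) (𝓝[>] 0)
      (𝓝 (ψ p + lam⁻¹ * inner ℝ (w - p) (y - p) - 0 * (1 / (2 * lam) * ‖y - p‖ ^ 2))) :=
    (Continuous.tendsto (by fun_prop) 0).mono_left nhdsWithin_le_nhds
  rw [zero_mul, sub_zero] at hlim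
  exact le_of_tendsto hlim (by
    filter_upwards [Ioo_mem_nhdsGT (zero_lt_one' ℝ)] with t ht using key t ht)

/-- The resolvent `w ↦ (w - p) / λ` is firmly nonexpansive up to scaling. -/
theorem inner_le_of_mem_proxSet (hψ : ConvexOn ℝ univ ψ) (hlam : 0 < lam) {w w' p p' : X}
    (hp : p ∈ proxSet lam ψ w) (hp' : p' ∈ proxSet lam ψ w') :
    0 ≤ inner ℝ ((w - p) - (w' - p')) (p - p') := by
  have h1 := subgradient_of_mem_proxSet hψ hlam hp p'
  have h2 := subgradient_of_mem_proxSet hψ hlam hp' p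
  have h3 : inner ℝ (w - p) (p' - p) = -inner ℝ (w - p) (p - p') := by
    rw [← inner_neg_right, neg_sub]
  rw [h3] at h1
  rw [inner_sub_left]
  have h4 : 0 ≤ lam⁻¹ * (inner ℝ (w - p) (p - p') - inner ℝ (w' - p') (p - p')) := by linarith
  exact nonneg_of_mul_nonneg_right h4 (inv_pos.2 hlam)

theorem proxSet_subsingleton (hψ : ConvexOn ℝ univ ψ) (hlam : 0 < lam) (w : X) :
    (proxSet lam ψ w).Subsingleton := by
  intro p hp p' hp'
  have h := inner_le_of_mem_proxSet hψ hlam hp hp'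
  have h1 : (w - p) - (w - p') = -(p - p') := by abel
  rw [h1, inner_neg_left, real_inner_self_eq_norm_sq] at h
  have : ‖p - p'‖ = 0 := by nlinarith [sq_nonneg ‖p - p'‖]
  exact sub_eq_zero.1 (norm_eq_zero.1 this)

theorem norm_sub_prox_le (hψ : ConvexOn ℝ univ ψ) (hlam : 0 < lam) {w w' p p' : X}
    (hp : p ∈ proxSet lam ψ w) (hp' : p' ∈ proxSet lam ψ w') :
    ‖(w - p) - (w' - p')‖ ≤ ‖w - w'‖ := by
  have h := inner_le_of_mem_proxSet hψ hlam hp hp'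
  have h1 : w - w' = ((w - p) - (w' - p')) + (p - p') := by abel
  have h2 := norm_add_sq_real ((w - p) - (w' - p')) (p - p')
  rw [← h1] at h2
  exact le_of_sq_le_sq (by nlinarith [sq_nonneg ‖p - p'‖]) (norm_nonneg _)

/-- The gradient inequality for the Moreau envelope. -/
theorem moreau_gradient_le (hψ : ConvexOn ℝ univ ψ) (hlam : 0 < lam) {w w' p p' : X}
    (hp : p ∈ proxSet lam ψ w) (hp' : p' ∈ proxSet lam ψ w') :
    moreau lam ψ w + inner ℝ (lam⁻¹ • (w - p)) (w' - w) ≤ moreau lam ψ w' := by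
  have h1 := subgradient_of_mem_proxSet hψ hlam hp p'
  rw [moreau_eq_of_mem_proxSet hp, moreau_eq_of_mem_proxSet hp']
  -- With this splitting, everything beyond the linear term assembles into the square in `h4`, which
  -- is discarded.
  have h2 : p' - p = (w' - w) - ((w' - p') - (w - p)) := by abel
  rw [h2, inner_sub_right, inner_sub_right (w - p) (w' - p'), real_inner_self_eq_norm_sq] at h1
  rw [real_inner_smul_left]
  have h3 := norm_sub_sq_real (w' - p') (w - p)
  rw [real_inner_comm] at h3
  have h4 : 0 ≤ 1 / (2 * lam) * ‖(w' - p') - (w - p)‖ ^ 2 := by positivity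
  rw [h3] at h4
  have h5 : 1 / (2 * lam) * (‖w' - p'‖ ^ 2 - 2 * inner ℝ (w - p) (w' - p') + ‖w - p‖ ^ 2)
    = 1 / (2 * lam) * ‖w' - p'‖ ^ 2 - lam⁻¹ * inner ℝ (w - p) (w' - p')
      + 1 / (2 * lam) * ‖w - p‖ ^ 2 := by
    field_simp
  have h6 : lam⁻¹ * ‖w - p‖ ^ 2 = 2 * (1 / (2 * lam) * ‖w - p‖ ^ 2) := by field_simp
  linarith

/-- Convexity along segments leaving the unit ball around w shows that ψ decreases at most linearly,
so the quadratic term makes the objective coercive. -/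
theorem proxSet_nonempty [FiniteDimensional ℝ X] (hψ : ConvexOn ℝ univ ψ) (hlam : 0 < lam)
    (w : X) : (proxSet lam ψ w).Nonempty := by
  have hc : Continuous ψ := continuousOn_univ.1 (hψ.continuousOn isOpen_univ)
  obtain ⟨c, hcw⟩ : ∃ c : ℝ, ∀ y ∈ Metric.closedBall w 1, c ≤ ψ y :=
    ((isCompact_closedBall w 1).bddBelow_image hc.continuousOn).imp fun c hc y hy =>
      hc (mem_image_of_mem _ hy)
  have hlow : ∀ y, c - (ψ w - c) * ‖w - y‖ ≤ ψ y := by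
    intro y
    have hw : c ≤ ψ w := hcw w (by simp)
    rcases le_or_gt ‖w - y‖ 1 with hy | hy
    · have := hcw y (by rwa [Metric.mem_closedBall, dist_comm, dist_eq_norm])
      nlinarith [norm_nonneg (w - y)]
    · set r := ‖w - y‖
      have hr : 0 < r := by linarith
      have hr1 : r⁻¹ ≤ 1 := inv_le_one_of_one_le₀ hy.le
      have h1 := hcw ((1 - r⁻¹) • w + r⁻¹ • y) (by
        have : (1 - r⁻¹) • w + r⁻¹ • y - w = - (r⁻¹ • (w - y)) := by module
        rw [Metric.mem_closedBall, dist_eq_norm, this, norm_neg, norm_smul, norm_inv, norm_norm,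
          inv_mul_cancel₀ hr.ne'])
      have h2 := hψ.2 (mem_univ w) (mem_univ y) (by linarith : 0 ≤ 1 - r⁻¹)
        (inv_nonneg.2 hr.le) (by ring)
      simp only [smul_eq_mul] at h2
      have h3 : r * c ≤ r * ((1 - r⁻¹) * ψ w + r⁻¹ * ψ y) :=
        mul_le_mul_of_nonneg_left (h1.trans h2) hr.le
      have h4 : r * ((1 - r⁻¹) * ψ w + r⁻¹ * ψ y) = r * ψ w - ψ w + ψ y := by field_simp
      nlinarith
  have hnorm : Tendsto (fun y => ‖w - y‖) (cocompact X) atTop :=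
    tendsto_norm_cocompact_atTop.comp (Homeomorph.subLeft w).isClosedEmbedding.tendsto_cocompact
  have hquad : Tendsto (fun r : ℝ => r * (1 / (2 * lam) * r - (ψ w - c))) atTop atTop :=
    tendsto_id.atTop_mul_atTop₀
      (tendsto_atTop_add_const_right _ (-(ψ w - c)) (tendsto_id.const_mul_atTop (by positivity)))
  have hlim : Tendsto (fun y => ψ y + 1 / (2 * lam) * ‖w - y‖ ^ 2) (cocompact X) atTop := by
    refine tendsto_atTop_mono (fun y => ?_)
      (tendsto_atTop_add_const_left _ c (hquad.comp hnorm))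
    have := hlow y
    simp only [Function.comp_apply]
    nlinarith
  obtain ⟨p, hp⟩ := Continuous.exists_forall_le (by fun_prop) hlim
  exact ⟨p, hp⟩

/-- A function with a Lipschitz selection of global subgradients is differentiable. -/
theorem hasGradientAt_of_subgradient_lipschitz [CompleteSpace X] {E : X → ℝ} {D : X → X} {k : ℝ}
    (hsub : ∀ w y, E w + inner ℝ (D w) (y - w) ≤ E y)
    (hlip : ∀ w y, ‖D w - D y‖ ≤ k * ‖w - y‖) (w : X) : HasGradientAt E (D w) w := by
  rw [hasGradientAt_iff_isLittleO]
  -- The subgradient inequalities at w and at y trap the remainder between 0 and ⟨D y - D w, y - w⟩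
  -- ≤ k‖y - w‖².
  have hO : (fun y => E y - E w - inner ℝ (D w) (y - w)) =O[𝓝 w] fun y => ‖y - w‖ ^ 2 := by
    refine Asymptotics.IsBigO.of_bound k (Eventually.of_forall fun y => ?_)
    have h1 := hsub w y
    have h2 := hsub y w
    have h3 : inner ℝ (D y) (w - y) = -inner ℝ (D y) (y - w) := by
      rw [← inner_neg_right, neg_sub]
    have h4 : inner ℝ (D y - D w) (y - w) ≤ k * ‖y - w‖ * ‖y - w‖ :=
      (real_inner_le_norm _ _).trans (mul_le_mul_of_nonneg_right (hlip y w) (norm_nonneg _))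
    rw [inner_sub_left] at h4
    rw [Real.norm_of_nonneg (by linarith), Real.norm_of_nonneg (by positivity)]
    nlinarith
  exact hO.trans_isLittleO (Asymptotics.isLittleO_pow_sub_sub w one_lt_two)

end ProximalPoint

theorem convexOn_add_sq_dist {X : Type*} [NormedAddCommGroup X] [InnerProductSpace ℝ X]
    {ψ : X → ℝ} (hψ : ConvexOn ℝ univ ψ) {c : ℝ} (hc : 0 ≤ c) (w : X) :
    ConvexOn ℝ univ fun y => ψ y + c * ‖w - y‖ ^ 2 := by
  have h1 : ConvexOn ℝ univ fun y => ‖y - w‖ := convexOn_univ_norm.comp_affineMap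
    (AffineMap.id ℝ X - AffineMap.const ℝ X w)
  have h2 := (h1.pow (fun _ _ => norm_nonneg _) 2).smul hc
  refine (hψ.add h2).congr fun y _ => ?_
  simp [norm_sub_rev w y]

/-! ### The supremum function, active vectors and minimax. -/

section SupFunction

variable {H Y : Type*} [NormedAddCommGroup Y] [NormedSpace ℝ Y] {m : ℕ}
  {C : Set (WeakDual ℝ Y)}

theorem continuous_scal (Φ : H → Euc m → Y) (h : H → ℝ) (w : Prod2 H m) :
    Continuous fun v : WeakDual ℝ Y => scal Φ h v w :=
  (WeakDual.eval_continuous _).add continuous_const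

/-- Zero lies in every positive dual cone, whereas the empty set generates the empty cone. -/
theorem nonempty_of_closure_coneOf {K : Set Y} (hgen : closure (coneOf C) = posDual K) :
    C.Nonempty := by
  have h0 : (0 : WeakDual ℝ Y) ∈ closure (coneOf C) := by
    rw [hgen]
    exact fun y _ => le_refl (0 : ℝ)
  obtain ⟨_, _, _, v, hv, _⟩ := closure_nonempty_iff.1 ⟨_, h0⟩
  exact ⟨v, hv⟩

theorem scal_le_supFun (hC : IsCompact C) (Φ : H → Euc m → Y) (h : H → ℝ) {v : WeakDual ℝ Y}
    (hv : v ∈ C) (w : Prod2 H m) : scal Φ h v w ≤ supFun Φ h C w := by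
  have hb := hC.bddAbove_image (continuous_scal Φ h w).continuousOn
  refine le_ciSup (f := fun v : C => scal Φ h v w) ?_ ⟨v, hv⟩
  rwa [image_eq_range] at hb

theorem exists_scal_eq_supFun (hC : IsCompact C) (hne : C.Nonempty) (Φ : H → Euc m → Y)
    (h : H → ℝ) (w : Prod2 H m) : ∃ v ∈ C, scal Φ h v w = supFun Φ h C w := by
  obtain ⟨v, hv, hmax⟩ := hC.exists_isMaxOn hne (continuous_scal Φ h w).continuousOn
  have := hne.to_subtype
  exact ⟨v, hv, le_antisymm (scal_le_supFun hC Φ h hv w) (ciSup_le fun u => hmax u.2)⟩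

theorem convexOn_supFun [NormedAddCommGroup H] [InnerProductSpace ℝ H] (hC : IsCompact C)
    (hne : C.Nonempty) {Φ : H → Euc m → Y} {h : H → ℝ}
    (hΦ : ∀ v ∈ C, ConvexOn ℝ univ (scal Φ h v)) : ConvexOn ℝ univ (supFun Φ h C) := by
  refine ⟨convex_univ, fun x _ y _ a b ha hb hab => ?_⟩
  obtain ⟨v, hv, hv'⟩ := exists_scal_eq_supFun hC hne Φ h (a • x + b • y)
  rw [← hv']
  refine ((hΦ v hv).2 (mem_univ x) (mem_univ y) ha hb hab).trans ?_
  simp only [smul_eq_mul]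
  gcongr <;> exact scal_le_supFun hC Φ h hv _

variable [NormedAddCommGroup H] [InnerProductSpace ℝ H] [FiniteDimensional ℝ H]
  {Φ : H → Euc m → Y} {h : H → ℝ} {lam : ℝ}

/-- Existence of an active vector, by the minimax theorem. -/
theorem exists_active (hC : IsCompact C) (hconv : Convex ℝ C) (hne : C.Nonempty)
    (hΦ : ∀ v ∈ C, ConvexOn ℝ univ (scal Φ h v)) (hlam : 0 < lam) (w : Prod2 H m) :
    ∃ v ∈ C, moreau lam (scal Φ h v) w = supEnv Φ h C lam w := by
  obtain ⟨p, hp⟩ := proxSet_nonempty (convexOn_supFun hC hne hΦ) hlam w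
  have hE : supEnv Φ h C lam w = supFun Φ h C p + 1 / (2 * lam) * ‖w - p‖ ^ 2 :=
    moreau_eq_of_mem_proxSet hp
  have hcv : ∀ v ∈ C, ConvexOn ℝ univ
      fun y => scal Φ h v y + 1 / (2 * lam) * ‖w - y‖ ^ 2 := fun v hv =>
    convexOn_add_sq_dist (hΦ v hv) (by positivity) w
  suffices ∃ v ∈ C, ∀ y, supEnv Φ h C lam w ≤ scal Φ h v y + 1 / (2 * lam) * ‖w - y‖ ^ 2 by
    obtain ⟨v, hv, hy⟩ := this
    refine ⟨v, hv, le_antisymm ?_ (le_ciInf hy)⟩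
    rw [hE]
    refine (ciInf_le ⟨_, by rintro _ ⟨y, rfl⟩; exact hy y⟩ p).trans ?_
    gcongr
    exact scal_le_supFun hC Φ h hv p
  -- Otherwise each v has a point y v with objective below the envelope. Compactness keeps finitely
  -- many of these points, and Sion's theorem replaces them by one y0 serving all of C. A v
  -- attaining the supremum at y0 then contradicts minimality of p.
  by_contra! hcon
  choose! y hy using hcon
  -- The sign is reversed because the minimax theorem takes the infimum over the compact variable,
  -- here v.
  let f : WeakDual ℝ Y → Prod2 H m → ℝ := fun v y =>
    -(scal Φ h v y + 1 / (2 * lam) * ‖w - y‖ ^ 2)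
  have hfcont : ∀ y, Continuous fun v => f v y := fun y =>
    ((continuous_scal Φ h y).add continuous_const).neg
  obtain ⟨t, htC, ht⟩ := hC.elim_nhds_subcover
    (fun v => {u | -supEnv Φ h C lam w < f u (y v)}) (fun v hv =>
      (isOpen_lt continuous_const (hfcont (y v))).mem_nhds (neg_lt_neg (hy v hv)))
  obtain ⟨y0, -, hy0⟩ := Sion.exists_lt_iInf_of_lt_iInf_of_finite (X := C) (Y := univ) (f := f)
    hne hC (fun y _ => (hfcont y).lowerSemicontinuous.lowerSemicontinuousOn _)
    (fun y _ => ConvexOn.quasiconvexOn ⟨hconv, fun v _ v' _ a b _ _ hab => by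
      have hb : b = 1 - a := by linarith
      subst hb
      simp only [f, scal, smul_eq_mul]
      refine le_of_eq ?_
      have : (a • v + (1 - a) • v') (Φ y.fst y.snd)
        = a * v (Φ y.fst y.snd) + (1 - a) * v' (Φ y.fst y.snd) := rfl
      rw [this]
      ring⟩)
    convex_univ
    (fun v hv => (((hcv v hv).continuousOn isOpen_univ).neg).upperSemicontinuousOn)
    (fun v hv => (hcv v hv).neg.quasiconcaveOn) hconv
    (t.finite_toSet.image y) (subset_univ _) (t := -supEnv Φ h C lam w) (fun v hv => by
      obtain ⟨u, hu, hvu⟩ := mem_iUnion₂.1 (ht hv)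
      exact ⟨y u, mem_image_of_mem _ hu, hvu⟩)
  obtain ⟨v, hv, hv'⟩ := exists_scal_eq_supFun hC hne Φ h y0
  have h1 := hy0 v hv
  have h2 := hp y0
  simp only [f] at h1
  rw [hv'] at h1
  linarith

/-- The scalarization lies below S, so its objective at p is at most the envelope of S, which by
activity is its own infimum. Hence p minimizes both objectives. -/
theorem proxSet_scal_of_active (hC : IsCompact C) {v : WeakDual ℝ Y} (hv : v ∈ C)
    (hΦ : ConvexOn ℝ univ (scal Φ h v)) (hlam : 0 < lam) {w p : Prod2 H m}
    (hp : p ∈ proxSet lam (supFun Φ h C) w)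
    (hact : moreau lam (scal Φ h v) w = supEnv Φ h C lam w) :
    proxSet lam (scal Φ h v) w = {p} := by
  obtain ⟨p', hp'⟩ := proxSet_nonempty hΦ hlam w
  have hmem : p ∈ proxSet lam (scal Φ h v) w := fun y =>
    calc scal Φ h v p + 1 / (2 * lam) * ‖w - p‖ ^ 2
        ≤ supFun Φ h C p + 1 / (2 * lam) * ‖w - p‖ ^ 2 := by
          gcongr
          exact scal_le_supFun hC Φ h hv p
      _ = moreau lam (scal Φ h v) w := by rw [hact]; exact (moreau_eq_of_mem_proxSet hp).symm
      _ ≤ _ := by rw [moreau_eq_of_mem_proxSet hp']; exact hp' y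
  exact (proxSet_subsingleton hΦ hlam w).eq_singleton_of_mem hmem

/-- The envelope of the supremum function has a Lipschitz field of subgradients. -/
theorem exists_gradient_supEnv (hC : IsCompact C) (hne : C.Nonempty)
    (hΦ : ∀ v ∈ C, ConvexOn ℝ univ (scal Φ h v)) (hlam : 0 < lam) :
    ∃ p : Prod2 H m → Prod2 H m, (∀ w, p w ∈ proxSet lam (supFun Φ h C) w) ∧
      (∀ w y, supEnv Φ h C lam w + inner ℝ (lam⁻¹ • (w - p w)) (y - w) ≤ supEnv Φ h C lam y) ∧
      ∀ w y, ‖lam⁻¹ • (w - p w) - lam⁻¹ • (y - p y)‖ ≤ lam⁻¹ * ‖w - y‖ := by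
  have hS := convexOn_supFun hC hne hΦ
  choose p hp using fun w => proxSet_nonempty hS hlam w
  refine ⟨p, hp, fun w y => moreau_gradient_le hS hlam (hp w) (hp y), fun w y => ?_⟩
  rw [← smul_sub, norm_smul, norm_inv, Real.norm_of_nonneg hlam.le]
  gcongr
  exact norm_sub_prox_le hS hlam (hp w) (hp y)

end SupFunction

/-! ### Gauges of sublevel sets under a uniform Slater condition. -/

section RadialGauge

variable {H Z : Type*} [NormedAddCommGroup Z] [NormedSpace ℝ Z]

/-- The gauge of the sublevel set `{z | g x z ≤ 0}`; along a ray it is the reciprocal of the radial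
function. -/
def levelGauge (g : H → Z → ℝ) (x : H) (u : Z) : ℝ := gauge {z | g x z ≤ 0} u

theorem levelGauge_nonneg (g : H → Z → ℝ) (x : H) (u : Z) : 0 ≤ levelGauge g x u := gauge_nonneg u

theorem levelGauge_smul (g : H → Z → ℝ) (x : H) {r : ℝ} (hr : 0 ≤ r) (u : Z) :
    levelGauge g x (r • u) = r * levelGauge g x u := gauge_smul_of_nonneg hr u

variable [NormedAddCommGroup H]

/-- A uniform Slater condition on `U`, with a Lipschitz bound in `x` of linear growth in `z`. -/
structure SlaterOn (g : H → Z → ℝ) (U : Set H) (ε δ M : ℝ) : Prop where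
  radius_pos : 0 < ε
  slack_pos : 0 < δ
  bound_nonneg : 0 ≤ M
  convexOn : ∀ x ∈ U, ConvexOn ℝ univ (g x)
  continuous : ∀ x ∈ U, Continuous (g x)
  nonpos : ∀ x ∈ U, ∀ z, ‖z‖ < ε → g x z ≤ 0
  slack : ∀ x ∈ U, g x 0 ≤ -δ
  lipschitz : ∀ x ∈ U, ∀ y ∈ U, ∀ z, g y z ≤ g x z + M * (1 + ‖z‖) * ‖y - x‖

variable {g : H → Z → ℝ} {U : Set H} {ε δ M : ℝ} {x : H}

namespace SlaterOn

theorem convex_sublevel (hg : SlaterOn g U ε δ M) (hx : x ∈ U) : Convex ℝ {z | g x z ≤ 0} := by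
  simpa using (hg.convexOn x hx).convex_le 0

theorem sublevel_mem_nhds (hg : SlaterOn g U ε δ M) (hx : x ∈ U) : {z | g x z ≤ 0} ∈ 𝓝 (0 : Z) :=
  mem_of_superset (Metric.ball_mem_nhds 0 hg.radius_pos) fun z hz =>
    hg.nonpos x hx z (mem_ball_zero_iff.1 hz)

theorem levelGauge_le_one_iff (hg : SlaterOn g U ε δ M) (hx : x ∈ U) {z : Z} :
    levelGauge g x z ≤ 1 ↔ g x z ≤ 0 := by
  rw [levelGauge, gauge_le_one_iff_mem_closure (hg.convex_sublevel hx) (hg.sublevel_mem_nhds hx),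
    IsClosed.closure_eq (isClosed_le (hg.continuous x hx) continuous_const)]
  rfl

/-- Such a z is a proper convex combination of a sublevel point and 0, where the slack is strict. -/
theorem neg_of_levelGauge_lt_one (hg : SlaterOn g U ε δ M) (hx : x ∈ U) {z : Z}
    (hz : levelGauge g x z < 1) : g x z < 0 := by
  obtain ⟨b, hb0, hb1, hb⟩ := exists_lt_of_gauge_lt
    (absorbent_nhds_zero (hg.sublevel_mem_nhds hx)) hz
  obtain ⟨y, hy, rfl⟩ := hb
  have h1 := (hg.convexOn x hx).2 (mem_univ y) (mem_univ 0) hb0.le (by linarith : 0 ≤ 1 - b)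
    (by ring)
  simp only [smul_zero, add_zero, smul_eq_mul] at h1
  have h2 := hg.slack x hx
  have h3 := hg.slack_pos
  have h4 : g x y ≤ 0 := hy
  refine h1.trans_lt ?_
  nlinarith

theorem levelGauge_eq_one_iff (hg : SlaterOn g U ε δ M) (hx : x ∈ U) {z : Z} :
    levelGauge g x z = 1 ↔ g x z = 0 := by
  have h1 := hg.levelGauge_le_one_iff hx (z := z)
  refine ⟨fun h => le_antisymm (h1.1 h.le) ?_, fun h => le_antisymm (h1.2 h.le) ?_⟩
  · by_contra! hlt
    have hopen : {z | g x z < 0} ⊆ interior {z | g x z ≤ 0} :=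
      interior_maximal (fun z (hz : g x z < 0) => show g x z ≤ 0 from hz.le)
        (isOpen_lt (hg.continuous x hx) continuous_const)
    exact absurd h (gauge_lt_one_iff_mem_interior (hg.convex_sublevel hx)
      (hg.sublevel_mem_nhds hx) |>.2 (hopen hlt)).ne
  · by_contra! hlt
    exact absurd h (hg.neg_of_levelGauge_lt_one hx hlt).ne

theorem levelGauge_le (hg : SlaterOn g U ε δ M) (hx : x ∈ U) (u : Z) :
    levelGauge g x u ≤ ε⁻¹ * ‖u‖ := by
  have h := mul_gauge_le_norm (s := {z | g x z ≤ 0}) (r := ε) (x := u) fun z hz =>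
    hg.nonpos x hx z (mem_ball_zero_iff.1 hz)
  rw [levelGauge, inv_mul_eq_div, le_div_iff₀ hg.radius_pos]
  linarith

/-- A point u/s of the sublevel set at x violates the constraint at y by at most a = M(1 + ‖u/s‖)‖y
- x‖. Contracting it towards 0 by δ/(δ + a) restores feasibility, so the gauge grows at most by the
factor 1 + a/δ. Linear growth in z is harmless: multiplied by s it becomes M(s + ‖u‖), which stays
bounded as s tends to 0. -/
theorem levelGauge_sub_le (hg : SlaterOn g U ε δ M) (hx : x ∈ U) {y : H} (hy : y ∈ U) (u : Z) :
    levelGauge g y u ≤ levelGauge g x u + M * (ε⁻¹ + 1) / δ * ‖u‖ * ‖y - x‖ := by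
  have hδ := hg.slack_pos
  have hM := hg.bound_nonneg
  have hd := norm_nonneg (y - x)
  have key : ∀ s, levelGauge g x u < s →
      levelGauge g y u ≤ s + M * (s + ‖u‖) / δ * ‖y - x‖ := by
    intro s hs
    have hs0 : 0 < s := (levelGauge_nonneg g x u).trans_lt hs
    have h1 : g x (s⁻¹ • u) ≤ 0 := by
      rw [← hg.levelGauge_le_one_iff hx, levelGauge_smul _ _ (by positivity), inv_mul_le_one₀ hs0]
      exact hs.le
    set a := M * (1 + ‖s⁻¹ • u‖) * ‖y - x‖ with ha
    have ha0 : 0 ≤ a := by positivity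
    have h2 : g y (s⁻¹ • u) ≤ a := by linarith [hg.lipschitz x hx y hy (s⁻¹ • u)]
    have h3 := (hg.convexOn y hy).2 (mem_univ (s⁻¹ • u)) (mem_univ 0)
      (by positivity : 0 ≤ δ / (δ + a)) (by positivity : 0 ≤ a / (δ + a))
      (by field_simp)
    have h4 : g y ((δ / (δ + a)) • s⁻¹ • u) ≤ 0 := by
      simp only [smul_zero, add_zero, smul_eq_mul] at h3
      refine h3.trans ?_
      calc δ / (δ + a) * g y (s⁻¹ • u) + a / (δ + a) * g y 0
          ≤ δ / (δ + a) * a + a / (δ + a) * (-δ) := by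
            gcongr
            exact hg.slack y hy
        _ = 0 := by ring
    rw [← hg.levelGauge_le_one_iff hy, smul_smul, levelGauge_smul _ _ (by positivity)] at h4
    have h5 : δ / (δ + a) * s⁻¹ = (s * (1 + a / δ))⁻¹ := by field_simp
    rw [h5, inv_mul_le_one₀ (by positivity)] at h4
    refine h4.trans (le_of_eq ?_)
    rw [ha, norm_smul, norm_inv, Real.norm_of_nonneg hs0.le]
    field_simp
  -- Letting s decrease to the gauge, instead of setting it equal, covers gauge zero.
  have hlim : Tendsto (fun s => s + M * (s + ‖u‖) / δ * ‖y - x‖) (𝓝[>] levelGauge g x u)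
      (𝓝 (levelGauge g x u + M * (levelGauge g x u + ‖u‖) / δ * ‖y - x‖)) :=
    (Continuous.tendsto (by fun_prop) _).mono_left nhdsWithin_le_nhds
  refine (ge_of_tendsto hlim (by
    filter_upwards [self_mem_nhdsWithin] with s hs using key s hs)).trans ?_
  have h6 := hg.levelGauge_le hx u
  have h7 : M * (levelGauge g x u + ‖u‖) / δ ≤ M * (ε⁻¹ + 1) / δ * ‖u‖ := by
    calc M * (levelGauge g x u + ‖u‖) / δ ≤ M * (ε⁻¹ * ‖u‖ + ‖u‖) / δ := by gcongr
      _ = _ := by ring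
  gcongr

theorem abs_levelGauge_sub_le (hg : SlaterOn g U ε δ M) {R : ℝ} {u : Z}
    (hu : ‖u‖ ≤ R) {x y : H} (hx : x ∈ U) (hy : y ∈ U) :
    |levelGauge g y u - levelGauge g x u| ≤ M * (ε⁻¹ + 1) / δ * R * ‖y - x‖ := by
  have hδ := hg.slack_pos
  have hε := hg.radius_pos
  have hM := hg.bound_nonneg
  have h1 := hg.levelGauge_sub_le hx hy u
  have h2 := hg.levelGauge_sub_le hy hx u
  rw [norm_sub_rev x y] at h2
  have h3 : M * (ε⁻¹ + 1) / δ * ‖u‖ * ‖y - x‖ ≤ M * (ε⁻¹ + 1) / δ * R * ‖y - x‖ := by gcongr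
  rw [abs_le]
  constructor <;> linarith

theorem continuousOn_levelGauge (hg : SlaterOn g U ε δ M) {R : ℝ} {T : Type*} [TopologicalSpace T]
    {u : T → Z} (hu : Continuous u) (hR : ∀ v, ‖u v‖ ≤ R) :
    ContinuousOn (fun q : H × T => levelGauge g q.1 (u q.2)) (U ×ˢ univ) := by
  refine continuousOn_prod_of_continuousOn_lipschitzOnWith _
    (Real.toNNReal (M * (ε⁻¹ + 1) / δ * R)) (fun x hx => ?_) fun v _ => ?_
  · exact ((continuous_gauge (hg.convex_sublevel hx)
      (hg.sublevel_mem_nhds hx)).comp hu).continuousOn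
  · refine LipschitzOnWith.of_dist_le_mul fun x hx y hy => ?_
    rw [Real.dist_eq, dist_eq_norm]
    refine (hg.abs_levelGauge_sub_le (hR v) hy hx).trans ?_
    gcongr
    exact Real.le_coe_toNNReal _

end SlaterOn

end RadialGauge

/-! ### Implicit differentiation from an a priori Lipschitz bound. -/

section ImplicitDerivative

variable {H : Type*} [NormedAddCommGroup H] [NormedSpace ℝ H]

/-- Differentiation of an implicitly defined function which is Lipschitz at the point. -/
theorem hasFDerivAt_of_implicit {F : H × ℝ → ℝ} {F' : H × ℝ →L[ℝ] ℝ} {σ : H → ℝ} {x₀ : H} {k : ℝ}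
    (hF : HasFDerivAt F F' (x₀, σ x₀)) (hzero : ∀ᶠ x in 𝓝 x₀, F (x, σ x) = 0)
    (hlip : ∀ᶠ x in 𝓝 x₀, |σ x - σ x₀| ≤ k * ‖x - x₀‖) (hF' : F' (0, 1) ≠ 0) :
    HasFDerivAt σ (-(F' (0, 1))⁻¹ • F'.comp (ContinuousLinearMap.inl ℝ H ℝ)) x₀ := by
  have hO : (fun x => σ x - σ x₀) =O[𝓝 x₀] fun x => x - x₀ :=
    Asymptotics.IsBigO.of_bound k (by simpa using hlip)
  have hO2 : (fun x => (x, σ x) - (x₀, σ x₀)) =O[𝓝 x₀] fun x => x - x₀ :=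
    (Asymptotics.isBigO_refl _ _).prod_left hO
  have hcont : Tendsto (fun x => (x, σ x)) (𝓝 x₀) (𝓝 (x₀, σ x₀)) := by
    refine (continuousAt_id (x := x₀)).prodMk_nhds ?_
    refine tendsto_sub_nhds_zero_iff.1 (hO.trans_tendsto ?_)
    exact tendsto_sub_nhds_zero_iff.2 tendsto_id
  have hF0 := hzero.self_of_nhds
  -- The Lipschitz bound makes the remainder of F small relative to x - x₀ alone; dividing by the
  -- partial derivative then isolates σ x - σ x₀.
  have ho := (hF.isLittleO.comp_tendsto hcont).trans_isBigO hO2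
  refine .of_isLittleO ?_
  refine ((ho.const_mul_left (-(F' (0, 1))⁻¹))).congr' ?_ EventuallyEq.rfl
  filter_upwards [hzero] with x hx
  have h1 : F' ((x, σ x) - (x₀, σ x₀)) = F' (x - x₀, 0) + (σ x - σ x₀) * F' (0, 1) := by
    rw [← smul_eq_mul, ← map_smul, ← map_add]
    simp
  simp only [Function.comp_apply, hx, hF0, h1]
  simp
  field_simp
  ring

end ImplicitDerivative

/-! ### The product Hilbert space. -/

section ProductSpace

variable {H : Type*} [NormedAddCommGroup H] {m : ℕ}

theorem norm_pair_zero_right (x : H) : ‖(pair x 0 : Prod2 H m)‖ = ‖x‖ := by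
  simp [pair]

theorem norm_pair_le (x : H) (z : Euc m) : ‖(pair x z : Prod2 H m)‖ ≤ ‖x‖ + ‖z‖ := by
  rw [WithLp.prod_norm_eq_of_L2]
  refine Real.sqrt_le_iff.2 ⟨by positivity, ?_⟩
  change ‖x‖ ^ 2 + ‖z‖ ^ 2 ≤ (‖x‖ + ‖z‖) ^ 2
  nlinarith [norm_nonneg x, norm_nonneg z]

theorem continuous_pair : Continuous fun q : H × Euc m => (pair q.1 q.2 : Prod2 H m) :=
  WithLp.prod_continuous_toLp 2 H (Euc m)

theorem pair_sub_pair (x y : H) (z z' : Euc m) :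
    (pair x z : Prod2 H m) - pair y z' = pair (x - y) (z - z') := rfl

theorem inner_pair [InnerProductSpace ℝ H] (d : Prod2 H m) (x : H) (z : Euc m) :
    inner ℝ d (pair x z) = inner ℝ d.fst x + inner ℝ d.snd z := by
  rw [WithLp.prod_inner_apply]
  rfl

end ProductSpace

/-! ### The gauge of the sublevel sets of a smooth convex envelope. -/

section EnvelopeGauge

variable {H : Type*} [NormedAddCommGroup H] [InnerProductSpace ℝ H] {m : ℕ}
  {E : Prod2 H m → ℝ} {D : Prod2 H m → Prod2 H m} {h : H → ℝ} {k : ℝ}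

theorem convexOn_of_subgradient {X : Type*} [NormedAddCommGroup X] [InnerProductSpace ℝ X]
    {E : X → ℝ} {D : X → X} (hsub : ∀ w y, E w + inner ℝ (D w) (y - w) ≤ E y) :
    ConvexOn ℝ univ E := by
  refine ⟨convex_univ, fun x _ y _ a b ha hb hab => ?_⟩
  have h1 := mul_le_mul_of_nonneg_left (hsub (a • x + b • y) x) ha
  have h2 := mul_le_mul_of_nonneg_left (hsub (a • x + b • y) y) hb
  have h3 : a * inner ℝ (D (a • x + b • y)) (x - (a • x + b • y))
      + b * inner ℝ (D (a • x + b • y)) (y - (a • x + b • y)) = 0 := by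
    rw [← real_inner_smul_right, ← real_inner_smul_right, ← inner_add_right]
    have : a • (x - (a • x + b • y)) + b • (y - (a • x + b • y)) = (0 : X) := by
      have hb' : b = 1 - a := by linarith
      subst hb'
      module
    rw [this, inner_zero_right]
  have h4 : E (a • x + b • y) = a * E (a • x + b • y) + b * E (a • x + b • y) := by
    rw [← add_mul, hab, one_mul]
  simp only [smul_eq_mul]
  linarith

theorem exists_slaterOn [CompleteSpace H] (hk : 0 ≤ k)
    (hsub : ∀ w y, E w + inner ℝ (D w) (y - w) ≤ E y)
    (hlip : ∀ w y, ‖D w - D y‖ ≤ k * ‖w - y‖) (hh : ContDiff ℝ 1 h) {xbar : H}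
    (hx : E (pair xbar 0) < h xbar) :
    ∃ ε δ M : ℝ, SlaterOn (fun x z => E (pair x z) - h x) (Metric.ball xbar ε) ε δ M := by
  have hEc : Continuous E := continuous_iff_continuousAt.2 fun w =>
    (hasGradientAt_of_subgradient_lipschitz hsub hlip w).continuousAt
  have hEconv := convexOn_of_subgradient hsub
  have hgc : Continuous fun q : H × Euc m => E (pair q.1 q.2) - h q.1 :=
    (hEc.comp continuous_pair).sub (hh.continuous.comp continuous_fst)
  obtain ⟨δ, hδ0, hδ⟩ : ∃ δ > 0, E (pair xbar 0) - h xbar < -δ :=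
    ⟨(h xbar - E (pair xbar 0)) / 2, by linarith, by linarith⟩
  obtain ⟨ε₁, hε₁, hball⟩ := Metric.eventually_nhds_iff_ball.1
    (hgc.continuousAt.eventually_lt continuousAt_const
      (show (fun q : H × Euc m => E (pair q.1 q.2) - h q.1) (xbar, 0) < -δ from hδ))
  obtain ⟨K, t, ht, hK⟩ := hh.contDiffAt (x := xbar) |>.exists_lipschitzOnWith
  obtain ⟨ε₂, hε₂, ht'⟩ := Metric.mem_nhds_iff.1 ht
  set ε := min ε₁ ε₂
  have hneg : ∀ x ∈ Metric.ball xbar ε, ∀ z : Euc m, ‖z‖ < ε → E (pair x z) - h x < -δ := by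
    intro x hx z hz
    refine hball (x, z) ?_
    rw [← ball_prod_same]
    exact ⟨Metric.ball_subset_ball (min_le_left _ _) hx,
      mem_ball_zero_iff.2 (hz.trans_le (min_le_left _ _))⟩
  have hε : 0 < ε := lt_min hε₁ hε₂
  -- The subgradient inequality at (y, z) bounds the variation of E in x by ‖D(y, z)‖, which grows
  -- linearly in z as D is k-Lipschitz; K is a local Lipschitz constant of h.
  refine ⟨ε, δ, ‖D (pair xbar 0)‖ + k * ε + k + K, hε, hδ0, by positivity,
    fun x _ => ?_, fun x _ => hgc.comp (by fun_prop : Continuous fun z : Euc m => (x, z)),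
    fun x hx z hz => ?_, fun x hx => ?_, fun x hx y hy z => ?_⟩
  · refine ⟨convex_univ, fun z _ z' _ a b ha hb hab => ?_⟩
    have h1 := hEconv.2 (mem_univ (pair x z)) (mem_univ (pair x z')) ha hb hab
    have h2 : a • (pair x z : Prod2 H m) + b • pair x z' = pair x (a • z + b • z') := by
      have : a • x + b • x = x := by rw [← add_smul, hab, one_smul]
      exact congrArg (fun y => (pair y (a • z + b • z') : Prod2 H m)) this
    rw [h2] at h1
    simp only [smul_eq_mul] at h1 ⊢
    have : h x = a * h x + b * h x := by rw [← add_mul, hab, one_mul]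
    linarith
  · linarith [hneg x hx z hz]
  · exact (hneg x hx 0 (by simpa using hε)).le
  · have h1 := hsub (pair y z) (pair x z)
    rw [pair_sub_pair, sub_self] at h1
    have h2 : -inner ℝ (D (pair y z)) (pair (x - y) 0) ≤ ‖D (pair y z)‖ * ‖y - x‖ := by
      refine (neg_le_abs _).trans ((abs_real_inner_le_norm _ _).trans_eq ?_)
      rw [norm_pair_zero_right, norm_sub_rev]
    have h3 : ‖D (pair y z)‖ ≤ ‖D (pair xbar 0)‖ + k * (ε + ‖z‖) := by
      have h4 := hlip (pair y z) (pair xbar 0)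
      rw [pair_sub_pair y xbar z 0, sub_zero] at h4
      have h5 : ‖(pair (y - xbar) z : Prod2 H m)‖ ≤ ε + ‖z‖ := by
        refine (norm_pair_le _ _).trans ?_
        gcongr
        rw [← dist_eq_norm]
        exact (Metric.mem_ball.1 hy).le
      have h6 := norm_le_norm_add_norm_sub (D (pair xbar 0)) (D (pair y z))
      have h7 : k * ‖(pair (y - xbar) z : Prod2 H m)‖ ≤ k * (ε + ‖z‖) := by gcongr
      rw [norm_sub_rev] at h6
      linarith
    have h8 : h x - h y ≤ K * ‖y - x‖ := by
      have := hK.dist_le_mul x (ht' (Metric.ball_subset_ball (min_le_right _ _) hx)) y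
        (ht' (Metric.ball_subset_ball (min_le_right _ _) hy))
      rw [Real.dist_eq, dist_eq_norm, norm_sub_rev] at this
      exact (le_abs_self _).trans this
    have h9 : ‖D (pair y z)‖ + K ≤ (‖D (pair xbar 0)‖ + k * ε + k + K) * (1 + ‖z‖) := by
      have a1 : 0 ≤ ‖D (pair xbar 0)‖ * ‖z‖ := by positivity
      have a2 : 0 ≤ k * ε * ‖z‖ := by positivity
      have a3 : 0 ≤ (K : ℝ) * ‖z‖ := by positivity
      nlinarith
    have h10 := mul_le_mul_of_nonneg_right h9 (norm_nonneg (y - x))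
    linarith

variable {U : Set H} {ε δ M : ℝ}

/-- The subgradient at a boundary point is tested at z = 0, where E - h ≤ -δ. This transversality
keeps the denominator of G nonzero. -/
theorem inner_snd_pos (hsub : ∀ w y, E w + inner ℝ (D w) (y - w) ≤ E y)
    (hg : SlaterOn (fun x z => E (pair x z) - h x) U ε δ M) {x : H} (hx : x ∈ U) {u : Euc m}
    {r : ℝ} (hr : 0 < r) (hz : E (pair x (r • u)) = h x) :
    0 < inner ℝ (D (pair x (r • u))).snd u := by
  have h1 := hsub (pair x (r • u)) (pair x 0)
  rw [pair_sub_pair, sub_self, zero_sub, inner_pair, inner_zero_right, zero_add, inner_neg_right,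
    real_inner_smul_right] at h1
  have h2 := hg.slack x hx
  have h3 := hg.slack_pos
  exact pos_of_mul_pos_right (by linarith : 0 < r * _) hr.le

/-- The gradient of the gauge of the sublevel set, by implicit differentiation. -/
theorem hasGradientAt_levelGauge [CompleteSpace H]
    (hsub : ∀ w y, E w + inner ℝ (D w) (y - w) ≤ E y)
    (hlip : ∀ w y, ‖D w - D y‖ ≤ k * ‖w - y‖) (hh : ContDiff ℝ 1 h)
    (hg : SlaterOn (fun x z => E (pair x z) - h x) U ε δ M) (hU : IsOpen U) {x₀ : H} (hx : x₀ ∈ U)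
    {u : Euc m} {s : ℝ} (hs : levelGauge (fun x z => E (pair x z) - h x) x₀ u = s) (hs0 : 0 < s) :
    HasGradientAt (fun x => levelGauge (fun x z => E (pair x z) - h x) x u)
      ((s ^ 2 / inner ℝ (D (pair x₀ (s⁻¹ • u))).snd u) •
        ((D (pair x₀ (s⁻¹ • u))).fst - gradient h x₀)) x₀ := by
  set σ := fun x => levelGauge (fun x z => E (pair x z) - h x) x u with hσ
  have hlev : ∀ x ∈ U, 0 < σ x → E (pair x ((σ x)⁻¹ • u)) - h x = 0 := fun x hx hpos => by
    rw [← hg.levelGauge_eq_one_iff hx, levelGauge_smul _ _ (by positivity)]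
    exact inv_mul_cancel₀ hpos.ne'
  have hσ0 : σ x₀ = s := hs
  set d := D (pair x₀ (s⁻¹ • u)) with hd
  have hpos : 0 < inner ℝ d.snd u :=
    inner_snd_pos hsub hg hx (inv_pos.2 hs0) (by
      have := hlev x₀ hx (by rwa [hσ0])
      rw [hσ0] at this
      linarith)
  have hnhds := hU.mem_nhds hx
  have hl : ∀ᶠ x in 𝓝 x₀, |σ x - σ x₀| ≤ M * (ε⁻¹ + 1) / δ * ‖u‖ * ‖x - x₀‖ := by
    filter_upwards [hnhds] with x hxU using hg.abs_levelGauge_sub_le le_rfl hx hxU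
  have hcont : ContinuousAt σ x₀ :=
    ((hg.continuousOn_levelGauge (T := Unit) (u := fun _ => u) (R := ‖u‖) (by fun_prop)
      (fun _ => le_rfl)).comp (f := fun x : H => (x, ())) (by fun_prop : ContinuousOn _ U)
      (fun x hx => ⟨hx, mem_univ _⟩)).continuousAt hnhds
  -- The implicit equation is E(x, u/t) = h(x) in the unknown t, solved by the gauge while it is
  -- positive. Differentiating u/t produces the factor s².
  have hzero : ∀ᶠ x in 𝓝 x₀,
      (fun q : H × ℝ => E (pair q.1 (q.2⁻¹ • u)) - h q.1) (x, σ x) = 0 := by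
    filter_upwards [hnhds, hcont.eventually (lt_mem_nhds (by rw [hσ0]; exact hs0))] with x hxU hxp
    exact hlev x hxU hxp
  have hE := (hasGradientAt_of_subgradient_lipschitz hsub hlip (pair x₀ (s⁻¹ • u))).hasFDerivAt
  have hpair : HasFDerivAt (fun q : H × ℝ => (pair q.1 (q.2⁻¹ • u) : Prod2 H m))
      ((WithLp.prodContinuousLinearEquiv 2 ℝ H (Euc m)).symm.toContinuousLinearMap.comp
        ((ContinuousLinearMap.fst ℝ H ℝ).prod
          (((-(s ^ 2)⁻¹) • (ContinuousLinearMap.snd ℝ H ℝ)).smulRight u))) (x₀, s) := by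
    have h1 : HasFDerivAt (fun q : H × ℝ => q.2⁻¹)
        ((-(s ^ 2)⁻¹) • (ContinuousLinearMap.snd ℝ H ℝ)) (x₀, s) :=
      (hasDerivAt_inv hs0.ne').comp_hasFDerivAt (x₀, s) hasFDerivAt_snd
    exact (WithLp.prodContinuousLinearEquiv 2 ℝ H (Euc m)).symm.hasFDerivAt.comp (x₀, s)
      (hasFDerivAt_fst.prodMk (h1.smul_const u))
  have hhd := ((hh.differentiable one_ne_zero) x₀).hasGradientAt.hasFDerivAt
  have hF := (hE.comp (x₀, s) hpair).sub (hhd.comp (x₀, s) hasFDerivAt_fst)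
  have hval : ∀ a b, ((((InnerProductSpace.toDual ℝ (Prod2 H m)) d).comp
      ((WithLp.prodContinuousLinearEquiv 2 ℝ H (Euc m)).symm.toContinuousLinearMap.comp
        ((ContinuousLinearMap.fst ℝ H ℝ).prod
          (((-(s ^ 2)⁻¹) • (ContinuousLinearMap.snd ℝ H ℝ)).smulRight u)))) -
      ((InnerProductSpace.toDual ℝ H) (gradient h x₀)).comp (ContinuousLinearMap.fst ℝ H ℝ)) (a, b)
      = inner ℝ (d.fst - gradient h x₀) a - b * ((s ^ 2)⁻¹ * inner ℝ d.snd u) := by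
    intro a b
    have : inner ℝ d (pair a ((-(s ^ 2)⁻¹ * b) • u)) - inner ℝ (gradient h x₀) a
      = inner ℝ (d.fst - gradient h x₀) a - b * ((s ^ 2)⁻¹ * inner ℝ d.snd u) := by
      rw [inner_pair, inner_sub_left, real_inner_smul_right]
      ring
    exact this
  have hres := hasFDerivAt_of_implicit (σ := σ) (by rw [hσ0]; exact hF) hzero hl (by
    rw [hval]
    simp only [inner_zero_right, one_mul, zero_sub]
    have : 0 < (s ^ 2)⁻¹ * inner ℝ d.snd u := by positivity
    linarith)
  rw [hasGradientAt_iff_hasFDerivAt]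
  refine hres.congr_fderiv (ContinuousLinearMap.ext fun a => ?_)
  rw [smul_apply, ContinuousLinearMap.comp_apply,
    ContinuousLinearMap.inl_apply, hval, hval, InnerProductSpace.toDual_apply_apply,
    real_inner_smul_left, inner_zero_right, smul_eq_mul,
    zero_sub, one_mul, zero_mul, sub_zero, inv_neg, neg_neg]
  field_simp

end EnvelopeGauge

/-! ### The radial density in the variable t = 1/r. -/

section RadialDensity

variable {m : ℕ}

/-- The density `θ` in the reciprocal radial variable `t = 1 / r`, extended by zero to `t ≤ 0`. -/
def radialDensity (L : Matrix (Fin m) (Fin m) ℝ) (f : Euc m → ℝ) (t : ℝ) (v : Sph m) : ℝ :=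
  if 0 < t then theta L f t⁻¹ v / t ^ 2 else 0

/-- The constant `2 π^{m/2} |det L| / Γ(m/2)`. -/
def thetaConst (L : Matrix (Fin m) (Fin m) ℝ) : ℝ :=
  2 * Real.pi ^ ((m : ℝ) / 2) * |L.det| / Real.Gamma ((m : ℝ) / 2)

variable {L : Matrix (Fin m) (Fin m) ℝ} {f : Euc m → ℝ}

theorem det_toEuclideanLin (L : Matrix (Fin m) (Fin m) ℝ) :
    LinearMap.det (Matrix.toEuclideanLin L) = L.det := LinearMap.det_toLpLin 2 L

theorem toEuclideanLin_ne_zero (hL : L.det ≠ 0) (v : Sph m) :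
    Matrix.toEuclideanLin L (v : Euc m) ≠ 0 := by
  have hdet : LinearMap.det (Matrix.toEuclideanLin L) ≠ 0 := by rwa [det_toEuclideanLin]
  have hinj : Function.Injective (Matrix.toEuclideanLin L) :=
    (LinearMap.equivOfDetNeZero _ hdet).injective
  intro h0
  have h1 : (v : Euc m) = 0 := hinj (h0.trans (map_zero _).symm)
  have h2 := norm_eq_of_mem_sphere v
  rw [h1, norm_zero] at h2
  exact zero_ne_one h2

theorem continuous_toEuclideanLin (L : Matrix (Fin m) (Fin m) ℝ) :
    Continuous (Matrix.toEuclideanLin L) := LinearMap.continuous_of_finiteDimensional _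

/-- The power m + 1 of the growth condition appears here: m - 1 from the polar Jacobian and 2 from
dr = -dt/t². -/
theorem radialDensity_of_pos (hm : 1 ≤ m) (hL : L.det ≠ 0) {t : ℝ} (ht : 0 < t) (v : Sph m) :
    radialDensity L f t v = thetaConst L / ‖Matrix.toEuclideanLin L (v : Euc m)‖ ^ (m + 1) *
      (‖t⁻¹ • Matrix.toEuclideanLin L (v : Euc m)‖ ^ (m + 1) *
        f (t⁻¹ • Matrix.toEuclideanLin L (v : Euc m))) := by
  have hn : 0 < ‖Matrix.toEuclideanLin L (v : Euc m)‖ :=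
    norm_pos_iff.2 (toEuclideanLin_ne_zero hL v)
  obtain ⟨n, rfl⟩ : ∃ n, m = n + 1 := ⟨m - 1, by omega⟩
  rw [radialDensity, if_pos ht, norm_smul, norm_inv, Real.norm_of_nonneg ht.le, theta, ray,
    ← thetaConst, mul_pow, Nat.add_sub_cancel]
  generalize f (t⁻¹ • Matrix.toEuclideanLin L (v : Euc (n + 1))) = c
  rw [inv_pow, inv_pow]
  field_simp
  ring

theorem radialDensity_nonneg (hm : 1 ≤ m) (hf : ∀ z, 0 ≤ f z) (t : ℝ) (v : Sph m) :
    0 ≤ radialDensity L f t v := by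
  have hg : 0 < Real.Gamma ((m : ℝ) / 2) := Real.Gamma_pos_of_pos (by positivity)
  rw [radialDensity]
  split_ifs with ht
  · have := hf (ray L t⁻¹ v)
    rw [theta]
    positivity
  · exact le_rfl

/-- The only delicate points have t = 0: as t decreases to 0, t⁻¹Lv leaves every bounded set, and
the growth condition makes the density vanish, matching the extension by zero. -/
theorem continuous_radialDensity (hm : 1 ≤ m) (hL : L.det ≠ 0) (hf : Continuous f)
    (hgrowth : Tendsto (fun z : Euc m => ‖z‖ ^ (m + 1) * f z) (Bornology.cobounded (Euc m)) (𝓝 0)) :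
    Continuous fun q : Sph m × ℝ => radialDensity L f q.2 q.1 := by
  have hLc : Continuous fun q : Sph m × ℝ => Matrix.toEuclideanLin L (q.1 : Euc m) :=
    (continuous_toEuclideanLin L).comp (continuous_subtype_val.comp continuous_fst)
  have hn : ∀ v : Sph m, ‖Matrix.toEuclideanLin L (v : Euc m)‖ ^ (m + 1) ≠ 0 := fun v =>
    pow_ne_zero _ (norm_ne_zero_iff.2 (toEuclideanLin_ne_zero hL v))
  have hcoef : Continuous fun q : Sph m × ℝ =>
      thetaConst L / ‖Matrix.toEuclideanLin L (q.1 : Euc m)‖ ^ (m + 1) :=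
    continuous_const.div (hLc.norm.pow _) fun q => hn q.1
  rw [continuous_iff_continuousAt]
  rintro ⟨v, t⟩
  rcases lt_trichotomy t 0 with ht | rfl | ht
  · refine (continuousAt_const (y := (0 : ℝ))).congr ?_
    filter_upwards [continuousAt_snd.eventually (gt_mem_nhds ht)] with q hq
    rw [radialDensity, if_neg (not_lt.2 (le_of_lt hq))]
  · have hz : radialDensity L f (v, (0 : ℝ)).2 (v, (0 : ℝ)).1 = 0 := by
      simp [radialDensity]
    rw [ContinuousAt, hz, ← nhdsWithin_univ, ← union_compl_self {q : Sph m × ℝ | 0 < q.2},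
      nhdsWithin_union]
    refine Tendsto.sup ?_ ?_
    · have h1 : Tendsto (fun q : Sph m × ℝ => q.2⁻¹ • Matrix.toEuclideanLin L (q.1 : Euc m))
          (𝓝[{q | 0 < q.2}] (v, 0)) (Bornology.cobounded (Euc m)) := by
        rw [← tendsto_norm_atTop_iff_cobounded]
        have h2 : Tendsto (fun q : Sph m × ℝ => q.2⁻¹) (𝓝[{q | 0 < q.2}] (v, 0)) atTop := by
          refine tendsto_inv_nhdsGT_zero.comp (tendsto_nhdsWithin_iff.2 ⟨?_, ?_⟩)
          · exact (continuous_snd.tendsto (v, (0 : ℝ))).mono_left nhdsWithin_le_nhds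
          · exact self_mem_nhdsWithin
        have h3 : Tendsto (fun q : Sph m × ℝ => ‖Matrix.toEuclideanLin L (q.1 : Euc m)‖)
            (𝓝[{q | 0 < q.2}] (v, 0)) (𝓝 ‖Matrix.toEuclideanLin L (v : Euc m)‖) :=
          (hLc.norm.tendsto (v, (0 : ℝ))).mono_left nhdsWithin_le_nhds
        refine (h2.atTop_mul_pos (norm_pos_iff.2 (toEuclideanLin_ne_zero hL v)) h3).congr' ?_
        filter_upwards [self_mem_nhdsWithin] with q (hq : 0 < q.2)
        rw [norm_smul, norm_inv, Real.norm_of_nonneg hq.le]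
      have h4 := ((hcoef.tendsto (v, 0)).mono_left nhdsWithin_le_nhds).mul (hgrowth.comp h1)
      rw [mul_zero] at h4
      refine h4.congr' ?_
      filter_upwards [self_mem_nhdsWithin] with q (hq : 0 < q.2)
      exact (radialDensity_of_pos hm hL hq q.1).symm
    · refine tendsto_const_nhds.congr' ?_
      filter_upwards [self_mem_nhdsWithin] with q (hq : ¬ 0 < q.2)
      rw [radialDensity, if_neg hq]
  · have h1 : ContinuousAt (fun q : Sph m × ℝ => q.2⁻¹ • Matrix.toEuclideanLin L (q.1 : Euc m))
        (v, t) := (continuousAt_snd.inv₀ ht.ne').smul hLc.continuousAt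
    refine (hcoef.continuousAt.mul ((h1.norm.pow (m + 1)).mul
      (hf.continuousAt.comp' h1))).congr ?_
    filter_upwards [continuousAt_snd.eventually (lt_mem_nhds ht)] with q hq
    exact (radialDensity_of_pos hm hL hq q.1).symm

end RadialDensity

/-! ### Polar coordinates and the spherical-radial decomposition. -/

section PolarCoordinates

variable {m : ℕ}

theorem lintegral_polar {E : Type*} [NormedAddCommGroup E] [NormedSpace ℝ E] [MeasurableSpace E]
    [BorelSpace E] [FiniteDimensional ℝ E] [Nontrivial E] (μ : Measure E) [μ.IsAddHaarMeasure]
    {G : E → ENNReal} (hG : Measurable G) :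
    ∫⁻ x, G x ∂μ = ∫⁻ v, (∫⁻ r in Ioi (0 : ℝ),
      ENNReal.ofReal (r ^ (Module.finrank ℝ E - 1)) * G (r • (v : E))) ∂μ.toSphere := by
  calc ∫⁻ x, G x ∂μ = ∫⁻ x : ({(0)}ᶜ : Set E), G x ∂(μ.comap (↑)) := by
        rw [lintegral_subtype_comap (measurableSet_singleton _).compl, restrict_compl_singleton]
    _ = ∫⁻ q : Metric.sphere (0 : E) 1 × Ioi (0 : ℝ), G (q.2.1 • (q.1 : E))
          ∂μ.toSphere.prod (.volumeIoiPow (Module.finrank ℝ E - 1)) := by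
        rw [← μ.measurePreserving_homeomorphUnitSphereProd.lintegral_comp_emb
          (Homeomorph.measurableEmbedding _)]
        refine lintegral_congr fun x => ?_
        congr 1
        exact (congrArg Subtype.val ((homeomorphUnitSphereProd E).symm_apply_apply x)).symm
    _ = ∫⁻ v, (∫⁻ r : Ioi (0 : ℝ), G (r.1 • (v : E))
          ∂(.volumeIoiPow (Module.finrank ℝ E - 1))) ∂μ.toSphere := by
        rw [lintegral_prod]
        exact (hG.comp (by fun_prop)).aemeasurable
    _ = _ := by
        refine lintegral_congr fun v => ?_
        have hGv : Measurable fun r : Ioi (0 : ℝ) => G (r.1 • (v : E)) := hG.comp (by fun_prop)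
        rw [Measure.volumeIoiPow, lintegral_withDensity_eq_lintegral_mul _ (by fun_prop) hGv]
        exact lintegral_subtype_comap measurableSet_Ioi
          fun r : ℝ => ENNReal.ofReal (r ^ (Module.finrank ℝ E - 1)) * G (r • (v : E))

theorem lintegral_Ioi_comp_inv (G : ℝ → ENNReal) :
    ∫⁻ r in Ioi (0 : ℝ), G r = ∫⁻ t in Ioi (0 : ℝ), ENNReal.ofReal (t ^ 2)⁻¹ * G t⁻¹ := by
  have himg : (fun t : ℝ => t⁻¹) '' Ioi 0 = Ioi 0 := by
    ext t
    simp
  have h := lintegral_image_eq_lintegral_abs_deriv_mul measurableSet_Ioi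
    (fun t (ht : t ∈ Ioi (0 : ℝ)) => (hasDerivAt_inv (ne_of_gt ht)).hasDerivWithinAt)
    (inv_injective.injOn) G
  rw [himg] at h
  rw [h]
  simp

/-- The constant in `theta` is this surface area times |det L|, so it cancels the normalization of
`sphereUnif`. -/
theorem toSphere_univ (hm : 1 ≤ m) : (volume : Measure (Euc m)).toSphere univ
    = ENNReal.ofReal (2 * Real.pi ^ ((m : ℝ) / 2) / Real.Gamma ((m : ℝ) / 2)) := by
  have : Nonempty (Fin m) := ⟨⟨0, hm⟩⟩
  have hm0 : (m : ℝ) / 2 ≠ 0 := by positivity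
  have hg : 0 < Real.Gamma ((m : ℝ) / 2) := Real.Gamma_pos_of_pos (by positivity)
  rw [Measure.toSphere_apply_univ, EuclideanSpace.volume_ball, Fintype.card_fin,
    finrank_euclideanSpace_fin, ENNReal.ofReal_one, one_pow, one_mul, ← ENNReal.ofReal_natCast,
    ← ENNReal.ofReal_mul (by positivity), Real.Gamma_add_one hm0]
  congr 1
  have : √Real.pi ^ m = Real.pi ^ ((m : ℝ) / 2) := by
    rw [Real.sqrt_eq_rpow, ← Real.rpow_natCast, ← Real.rpow_mul Real.pi_pos.le]
    congr 1
    ring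
  rw [this]
  field_simp

theorem isProbabilityMeasure_sphereUnif (hm : 1 ≤ m) : IsProbabilityMeasure (sphereUnif m) := by
  have : Nonempty (Fin m) := ⟨⟨0, hm⟩⟩
  refine ⟨?_⟩
  rw [sphereUnif, Measure.smul_apply, smul_eq_mul]
  exact ENNReal.inv_mul_cancel (Measure.measure_univ_ne_zero.2 (Measure.toSphere_ne_zero _))
    (measure_ne_top _ _)

variable {L : Matrix (Fin m) (Fin m) ℝ} {f : Euc m → ℝ}

theorem continuous_integral_radialDensity (hm : 1 ≤ m) (hL : L.det ≠ 0) (hf : Continuous f)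
    (hgrowth : Tendsto (fun z : Euc m => ‖z‖ ^ (m + 1) * f z) (Bornology.cobounded (Euc m)) (𝓝 0))
    {s : Sph m → ℝ} (hs : Continuous s) :
    Continuous fun v => ∫ t in 0..s v, radialDensity L f t v :=
  intervalIntegral.continuous_parametric_intervalIntegral_of_continuous
    (continuous_radialDensity hm hL hf hgrowth) hs

/-- Spherical-radial decomposition of the measure with density `f` on the complement of a star-shaped
set, in the reciprocal radial variable. -/
theorem withDensity_apply_eq_integral_sphere (hm : 1 ≤ m) (hL : L.det ≠ 0) (hf : Continuous f)
    (hf0 : ∀ z, 0 ≤ f z)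
    (hgrowth : Tendsto (fun z : Euc m => ‖z‖ ^ (m + 1) * f z) (Bornology.cobounded (Euc m)) (𝓝 0))
    {s : Sph m → ℝ} (hs : Continuous s) (hs0 : ∀ v, 0 ≤ s v) {B : Set (Euc m)}
    (hB : MeasurableSet B) (hmem : ∀ r, 0 < r → ∀ v, ray L r v ∈ B ↔ 1 < r * s v) :
    (volume : Measure (Euc m)).withDensity (fun z => ENNReal.ofReal (f z)) B
      = ENNReal.ofReal (∫ v, (∫ t in 0..s v, radialDensity L f t v) ∂(sphereUnif m)) := by
  have : Nonempty (Fin m) := ⟨⟨0, hm⟩⟩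
  have := isProbabilityMeasure_sphereUnif hm
  have hg : 0 < Real.Gamma ((m : ℝ) / 2) := Real.Gamma_pos_of_pos (by positivity)
  have hdet : LinearMap.det (Matrix.toEuclideanLin L) ≠ 0 := by rwa [det_toEuclideanLin]
  have hLm : Measurable (Matrix.toEuclideanLin L) := (continuous_toEuclideanLin L).measurable
  set F : Euc m → ENNReal := B.indicator fun z => ENNReal.ofReal (f z) with hF
  have hFm : Measurable F := (hf.measurable.ennreal_ofReal).indicator hB
  -- The substitution t = 1/r turns the part of the ray outside the star-shaped set, r > 1/s, into
  -- the bounded interval 0 < t < s.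
  have hinner : ∀ v : Sph m, ENNReal.ofReal (∫ t in 0..s v, radialDensity L f t v)
      = (volume : Measure (Euc m)).toSphere univ * (ENNReal.ofReal |L.det| *
        ∫⁻ r in Ioi (0 : ℝ), ENNReal.ofReal (r ^ (m - 1)) *
          F (Matrix.toEuclideanLin L (r • (v : Euc m)))) := by
    intro v
    have hqc : Continuous fun t => radialDensity L f t v :=
      (continuous_radialDensity hm hL hf hgrowth).comp (by fun_prop : Continuous fun t => (v, t))
    rw [intervalIntegral.integral_of_le (hs0 v), ofReal_integral_eq_lintegral_ofReal
      (hqc.integrableOn_Icc.mono_set Ioc_subset_Icc_self)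
      (ae_of_all _ fun t => radialDensity_nonneg hm hf0 t v), lintegral_Ioi_comp_inv,
      toSphere_univ hm, ← mul_assoc, ← ENNReal.ofReal_mul (by positivity),
      ← lintegral_const_mul' _ _ ENNReal.ofReal_ne_top, Measure.restrict_congr_set Ioo_ae_eq_Ioc.symm,
      ← lintegral_indicator measurableSet_Ioo, ← lintegral_indicator measurableSet_Ioi]
    refine lintegral_congr fun t => ?_
    by_cases ht : 0 < t
    · have h1 : Matrix.toEuclideanLin L (t⁻¹ • (v : Euc m)) = ray L t⁻¹ v := by
        rw [map_smul, ray]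
      have h2 : ray L t⁻¹ v ∈ B ↔ t < s v := by
        rw [hmem _ (inv_pos.2 ht), inv_mul_eq_div, one_lt_div ht]
      rw [indicator_of_mem (show t ∈ Ioi 0 from ht), h1]
      by_cases hts : t < s v
      · rw [indicator_of_mem (show t ∈ Ioo 0 (s v) from ⟨ht, hts⟩), hF,
          indicator_of_mem (h2.2 hts), radialDensity, if_pos ht, theta,
          ← ENNReal.ofReal_mul (by positivity), ← ENNReal.ofReal_mul (by positivity),
          ← ENNReal.ofReal_mul (by positivity)]
        congr 1
        ring
      · rw [indicator_of_notMem (fun h => hts h.2), hF, indicator_of_notMem (fun h => hts (h2.1 h)),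
          mul_zero, mul_zero, mul_zero]
    · rw [indicator_of_notMem (fun h => ht h.1), indicator_of_notMem (show t ∉ Ioi 0 from ht)]
  have hJ := continuous_integral_radialDensity hm hL hf hgrowth hs
  have hc0 : (volume : Measure (Euc m)).toSphere univ ≠ 0 :=
    Measure.measure_univ_ne_zero.2 (Measure.toSphere_ne_zero _)
  rw [ofReal_integral_eq_lintegral_ofReal
    (hJ.integrable_of_hasCompactSupport (HasCompactSupport.of_compactSpace _))
    (ae_of_all _ fun v => intervalIntegral.integral_nonneg (hs0 v) fun t _ =>
      radialDensity_nonneg hm hf0 t v)]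
  simp_rw [hinner]
  rw [lintegral_const_mul' _ _ (measure_ne_top _ _), lintegral_const_mul' _ _ ENNReal.ofReal_ne_top,
    sphereUnif, lintegral_smul_measure, smul_eq_mul, mul_left_comm (ENNReal.ofReal |L.det|),
    ← mul_assoc, ENNReal.mul_inv_cancel hc0 (measure_ne_top _ _), one_mul,
    withDensity_apply _ hB, ← lintegral_indicator hB]
  have hpol := lintegral_polar (volume : Measure (Euc m)) (hFm.comp hLm)
  rw [finrank_euclideanSpace_fin] at hpol
  simp only [Function.comp_apply] at hpol
  -- The change of variables by L contributes |det L|⁻¹, cancelling the determinant in `theta`.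
  rw [← hpol, ← lintegral_map hFm hLm, Measure.map_linearMap_addHaar_eq_smul_addHaar _ hdet,
    lintegral_smul_measure, smul_eq_mul, ← mul_assoc, ← ENNReal.ofReal_mul (abs_nonneg _),
    det_toEuclideanLin, ← abs_mul, mul_inv_cancel₀ hL, abs_one, ENNReal.ofReal_one, one_mul]

end PolarCoordinates

/-! ### Differentiation of the mass of a single ray. -/

section Differentiation

variable {H : Type*} {m : ℕ}

/-- The gauge of `{z | E (x, z) ≤ h x}` in the direction `L v`. -/
def dirGauge (E : Prod2 H m → ℝ) (h : H → ℝ) (L : Matrix (Fin m) (Fin m) ℝ) (x : H) (v : Sph m) :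
    ℝ :=
  levelGauge (fun x z => E (pair x z) - h x) x (Matrix.toEuclideanLin L (v : Euc m))

theorem dirGauge_nonneg (E : Prod2 H m → ℝ) (h : H → ℝ) (L : Matrix (Fin m) (Fin m) ℝ) (x : H)
    (v : Sph m) : 0 ≤ dirGauge E h L x v := levelGauge_nonneg _ _ _

/-- The mass of the ray in direction `v` outside the sublevel set. -/
def tailMass (E : Prod2 H m → ℝ) (h : H → ℝ) (L : Matrix (Fin m) (Fin m) ℝ) (f : Euc m → ℝ)
    (x : H) (v : Sph m) : ℝ :=
  ∫ t in 0..dirGauge E h L x v, radialDensity L f t v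

variable [NormedAddCommGroup H]

variable {E : Prod2 H m → ℝ} {h : H → ℝ} {U : Set H} {ε δ M : ℝ} {L : Matrix (Fin m) (Fin m) ℝ}
  {f : Euc m → ℝ}

theorem exists_norm_toEuclideanLin_le (L : Matrix (Fin m) (Fin m) ℝ) :
    ∃ R : ℝ, 0 ≤ R ∧ ∀ v : Sph m, ‖Matrix.toEuclideanLin L (v : Euc m)‖ ≤ R := by
  refine ⟨‖(Matrix.toEuclideanLin L).toContinuousLinearMap‖, norm_nonneg _, fun v => ?_⟩
  simpa using (Matrix.toEuclideanLin L).toContinuousLinearMap.le_opNorm (v : Euc m)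

theorem continuous_toEuclideanLin_sphere (L : Matrix (Fin m) (Fin m) ℝ) :
    Continuous fun v : Sph m => Matrix.toEuclideanLin L (v : Euc m) :=
  (continuous_toEuclideanLin L).comp continuous_subtype_val

theorem continuousOn_dirGauge (hg : SlaterOn (fun x z => E (pair x z) - h x) U ε δ M)
    (L : Matrix (Fin m) (Fin m) ℝ) :
    ContinuousOn (fun q : H × Sph m => dirGauge E h L q.1 q.2) (U ×ˢ univ) := by
  obtain ⟨R, -, hR⟩ := exists_norm_toEuclideanLin_le L
  have h1 := hg.continuousOn_levelGauge (T := Sph m)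
    (u := fun v => Matrix.toEuclideanLin L (v : Euc m)) (continuous_toEuclideanLin_sphere L) hR
  exact h1

theorem continuous_dirGauge_right (hg : SlaterOn (fun x z => E (pair x z) - h x) U ε δ M)
    (L : Matrix (Fin m) (Fin m) ℝ) {x : H} (hx : x ∈ U) : Continuous (dirGauge E h L x) :=
  (continuous_gauge (hg.convex_sublevel hx) (hg.sublevel_mem_nhds hx)).comp
    (continuous_toEuclideanLin_sphere L)

/-- `dirGauge` is Lipschitz in `x`, uniformly in the direction. -/
theorem exists_lipschitz_dirGauge (hg : SlaterOn (fun x z => E (pair x z) - h x) U ε δ M)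
    (L : Matrix (Fin m) (Fin m) ℝ) :
    ∃ K : ℝ, 0 ≤ K ∧ ∀ v, ∀ x ∈ U, ∀ y ∈ U,
      |dirGauge E h L y v - dirGauge E h L x v| ≤ K * ‖y - x‖ := by
  obtain ⟨R, hR0, hR⟩ := exists_norm_toEuclideanLin_le L
  have h1 := hg.radius_pos
  have h2 := hg.slack_pos
  have h3 := hg.bound_nonneg
  exact ⟨M * (ε⁻¹ + 1) / δ * R, by positivity, fun v x hx y hy =>
    hg.abs_levelGauge_sub_le (hR v) hx hy⟩

theorem exists_dirGauge_le (hg : SlaterOn (fun x z => E (pair x z) - h x) U ε δ M)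
    (L : Matrix (Fin m) (Fin m) ℝ) : ∃ B : ℝ, ∀ v, ∀ x ∈ U, dirGauge E h L x v ≤ B := by
  obtain ⟨R, hR0, hR⟩ := exists_norm_toEuclideanLin_le L
  have h1 := hg.radius_pos
  refine ⟨ε⁻¹ * R, fun v x hx => (hg.levelGauge_le hx _).trans ?_⟩
  gcongr
  exact hR v

theorem hasDerivAt_integral_radialDensity (hm : 1 ≤ m) (hL : L.det ≠ 0) (hf : Continuous f)
    (hgrowth : Tendsto (fun z : Euc m => ‖z‖ ^ (m + 1) * f z) (Bornology.cobounded (Euc m)) (𝓝 0))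
    (v : Sph m) (s : ℝ) :
    HasDerivAt (fun s => ∫ t in 0..s, radialDensity L f t v) (radialDensity L f s v) s := by
  have hqc : Continuous fun t => radialDensity L f t v :=
    (continuous_radialDensity hm hL hf hgrowth).comp (by fun_prop : Continuous fun t => (v, t))
  exact intervalIntegral.integral_hasDerivAt_right (hqc.intervalIntegrable _ _)
    (hqc.stronglyMeasurableAtFilter _ _) hqc.continuousAt

/-- The gauge stays in a fixed interval [0, B], and the density is bounded on the compact set of
directions times this interval. The resulting constant later serves as dominating function. -/
theorem exists_lipschitz_tailMass (hg : SlaterOn (fun x z => E (pair x z) - h x) U ε δ M)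
    (hm : 1 ≤ m) (hL : L.det ≠ 0) (hf : Continuous f)
    (hgrowth : Tendsto (fun z : Euc m => ‖z‖ ^ (m + 1) * f z)
      (Bornology.cobounded (Euc m)) (𝓝 0)) :
    ∃ K : ℝ, 0 ≤ K ∧ ∀ v, ∀ x ∈ U, ∀ y ∈ U,
      ‖tailMass E h L f y v - tailMass E h L f x v‖ ≤ K * ‖y - x‖ := by
  obtain ⟨K, hK0, hK⟩ := exists_lipschitz_dirGauge hg L
  obtain ⟨B, hB⟩ := exists_dirGauge_le hg L
  have hq := continuous_radialDensity hm hL hf hgrowth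
  obtain ⟨Q, hQ⟩ := ((isCompact_univ (X := Sph m)).prod (isCompact_Icc (a := (0 : ℝ)) (b := B))
    ).exists_bound_of_continuousOn hq.continuousOn
  refine ⟨|Q| * K, by positivity, fun v x hx y hy => ?_⟩
  have hmem : ∀ z ∈ U, dirGauge E h L z v ∈ Icc 0 B := fun z hz =>
    ⟨dirGauge_nonneg _ _ _ _ _, hB v z hz⟩
  have h1 := (convex_Icc (0 : ℝ) B).norm_image_sub_le_of_norm_hasDerivWithin_le
    (fun s _ => (hasDerivAt_integral_radialDensity hm hL hf hgrowth v s).hasDerivWithinAt)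
    (fun s hs => hQ (v, s) ⟨mem_univ _, hs⟩) (hmem x hx) (hmem y hy)
  refine h1.trans ?_
  rw [Real.norm_eq_abs, mul_assoc]
  exact mul_le_mul (le_abs_self Q) (hK v x hx y hy) (abs_nonneg _) (abs_nonneg _)

variable [InnerProductSpace ℝ H] [CompleteSpace H] {D : Prod2 H m → Prod2 H m} {k : ℝ}

/-- The gradient in `x` of the gauge of `{z | E (x, z) ≤ h x}` in the direction `u`, where the gauge
has the value `s > 0`. -/
def gaugeGradient (D : Prod2 H m → Prod2 H m) (h : H → ℝ) (x : H) (u : Euc m)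
    (s : ℝ) : H :=
  (s ^ 2 / inner ℝ (D (pair x (s⁻¹ • u))).snd u) •
    ((D (pair x (s⁻¹ • u))).fst - gradient h x)

/-- The gradient in `x` of the mass of the ray in direction `v` outside the sublevel set. -/
def tailGradient (E : Prod2 H m → ℝ) (D : Prod2 H m → Prod2 H m) (h : H → ℝ)
    (L : Matrix (Fin m) (Fin m) ℝ) (f : Euc m → ℝ) (x : H) (v : Sph m) : H :=
  radialDensity L f (dirGauge E h L x v) v •
    gaugeGradient D h x (Matrix.toEuclideanLin L (v : Euc m)) (dirGauge E h L x v)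

theorem hasGradientAt_dirGauge (hsub : ∀ w y, E w + inner ℝ (D w) (y - w) ≤ E y)
    (hlip : ∀ w y, ‖D w - D y‖ ≤ k * ‖w - y‖) (hh : ContDiff ℝ 1 h)
    (hg : SlaterOn (fun x z => E (pair x z) - h x) U ε δ M) (hU : IsOpen U) {x : H} (hx : x ∈ U)
    {v : Sph m} (hpos : 0 < dirGauge E h L x v) :
    HasGradientAt (fun y => dirGauge E h L y v)
      (gaugeGradient D h x (Matrix.toEuclideanLin L (v : Euc m)) (dirGauge E h L x v)) x :=
  hasGradientAt_levelGauge hsub hlip hh hg hU hx rfl hpos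

theorem norm_le_of_hasGradientAt {F : H → ℝ} {d x : H} {K : ℝ} (hF : HasGradientAt F d x)
    (hU : U ∈ 𝓝 x) (hK : 0 ≤ K) (hl : ∀ y ∈ U, ‖F y - F x‖ ≤ K * ‖y - x‖) : ‖d‖ ≤ K := by
  have h1 := hF.hasFDerivAt.le_of_lip' hK (by filter_upwards [hU] with y hy using hl y hy)
  simpa using h1

/-- Where the gauge is positive this is the chain rule. Where it is zero, differentiability of the
gauge is not available, but the density vanishes there and the gauge is Lipschitz, so the increment
is o(‖y - x‖). -/
theorem hasGradientAt_tailMass (hsub : ∀ w y, E w + inner ℝ (D w) (y - w) ≤ E y)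
    (hlip : ∀ w y, ‖D w - D y‖ ≤ k * ‖w - y‖) (hh : ContDiff ℝ 1 h)
    (hg : SlaterOn (fun x z => E (pair x z) - h x) U ε δ M) (hU : IsOpen U)
    (hm : 1 ≤ m) (hL : L.det ≠ 0) (hf : Continuous f)
    (hgrowth : Tendsto (fun z : Euc m => ‖z‖ ^ (m + 1) * f z) (Bornology.cobounded (Euc m)) (𝓝 0))
    {x : H} (hx : x ∈ U) (v : Sph m) :
    HasGradientAt (fun y => tailMass E h L f y v) (tailGradient E D h L f x v) x := by
  have hJ := hasDerivAt_integral_radialDensity hm hL hf hgrowth v (dirGauge E h L x v)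
  rw [hasGradientAt_iff_hasFDerivAt]
  rcases (dirGauge_nonneg E h L x v).eq_or_lt with h0 | hpos
  · obtain ⟨K, hK0, hK⟩ := exists_lipschitz_dirGauge hg L
    have hq0 : radialDensity L f (dirGauge E h L x v) v = 0 := by
      rw [← h0]
      simp [radialDensity]
    have hO : (fun y => dirGauge E h L y v - dirGauge E h L x v) =O[𝓝 x] fun y => y - x :=
      Asymptotics.IsBigO.of_bound K (by
        filter_upwards [hU.mem_nhds hx] with y hy using hK v x hx y hy)
    have hcont : Tendsto (fun y => dirGauge E h L y v) (𝓝 x) (𝓝 (dirGauge E h L x v)) :=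
      tendsto_sub_nhds_zero_iff.1
        (hO.trans_tendsto (tendsto_sub_nhds_zero_iff.2 tendsto_id))
    have ho := (hJ.hasFDerivAt.isLittleO.comp_tendsto hcont).trans_isBigO hO
    refine .of_isLittleO (ho.congr_left fun y => ?_)
    simp [tailGradient, tailMass, hq0]
  · have h1 := (hasGradientAt_dirGauge (L := L) hsub hlip hh hg hU hx hpos).hasFDerivAt
    refine (hJ.comp_hasFDerivAt x h1).congr_fderiv ?_
    rw [tailGradient, map_smulₛₗ]
    rfl

theorem continuous_gradient (hh : ContDiff ℝ 1 h) : Continuous (gradient h) :=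
  (InnerProductSpace.toDual ℝ H).symm.continuous.comp (hh.continuous_fderiv one_ne_zero)

/-- At a zero of the gauge, `gaugeGradient` may have no limit, but wherever the gauge is positive it
is bounded by the Lipschitz constant K, and the density factor tends to 0. -/
theorem continuousOn_tailGradient (hsub : ∀ w y, E w + inner ℝ (D w) (y - w) ≤ E y)
    (hlip : ∀ w y, ‖D w - D y‖ ≤ k * ‖w - y‖) (hk : 0 ≤ k) (hh : ContDiff ℝ 1 h)
    (hg : SlaterOn (fun x z => E (pair x z) - h x) U ε δ M) (hU : IsOpen U)
    (hm : 1 ≤ m) (hL : L.det ≠ 0) (hf : Continuous f)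
    (hgrowth : Tendsto (fun z : Euc m => ‖z‖ ^ (m + 1) * f z)
      (Bornology.cobounded (Euc m)) (𝓝 0)) :
    ContinuousOn (fun q : H × Sph m => tailGradient E D h L f q.1 q.2) (U ×ˢ univ) := by
  have hUo : IsOpen (U ×ˢ (univ : Set (Sph m))) := hU.prod isOpen_univ
  have hDc : Continuous D := (LipschitzWith.of_dist_le_mul (K := ⟨k, hk⟩) fun w y => by
    rw [dist_eq_norm, dist_eq_norm]
    exact hlip w y).continuous
  intro ⟨x, v⟩ hxv
  have hx : x ∈ U := hxv.1
  refine ContinuousAt.continuousWithinAt ?_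
  have hnhds := hUo.mem_nhds hxv
  have hs : ContinuousAt (fun q : H × Sph m => dirGauge E h L q.1 q.2) (x, v) :=
    (continuousOn_dirGauge hg L).continuousAt hnhds
  have hq : ContinuousAt
      (fun q : H × Sph m => radialDensity L f (dirGauge E h L q.1 q.2) q.2) (x, v) :=
    (continuous_radialDensity hm hL hf hgrowth).continuousAt.comp'
      (f := fun q : H × Sph m => (q.2, dirGauge E h L q.1 q.2)) (continuousAt_snd.prodMk hs)
  rcases (dirGauge_nonneg E h L x v).eq_or_lt with h0 | hpos
  · obtain ⟨K, hK0, hK⟩ := exists_lipschitz_dirGauge hg L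
    have hq0 : radialDensity L f (dirGauge E h L x v) v = 0 := by
      rw [← h0]
      simp [radialDensity]
    have hv0 : tailGradient E D h L f (x, v).1 (x, v).2 = 0 := by
      simp [tailGradient, hq0]
    rw [ContinuousAt, hv0]
    have hlim : Tendsto (fun q : H × Sph m =>
        ‖radialDensity L f (dirGauge E h L q.1 q.2) q.2‖ * K) (𝓝 (x, v)) (𝓝 0) := by
      have := (hq.norm.tendsto).mul_const K
      simpa [hq0] using this
    refine squeeze_zero_norm' ?_ hlim
    filter_upwards [hnhds] with q hqU
    rw [tailGradient, norm_smul]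
    rcases (dirGauge_nonneg E h L q.1 q.2).eq_or_lt with h0' | hpos'
    · rw [← h0']
      simp [radialDensity]
    · gcongr
      exact norm_le_of_hasGradientAt (hasGradientAt_dirGauge hsub hlip hh hg hU hqU.1 hpos')
        (hU.mem_nhds hqU.1) hK0 fun y hy => hK q.2 q.1 hqU.1 y hy
  · refine hq.smul ?_
    have hLv : ContinuousAt (fun q : H × Sph m => Matrix.toEuclideanLin L (q.2 : Euc m)) (x, v) :=
      ((continuous_toEuclideanLin_sphere L).comp continuous_snd).continuousAt
    have hz : ContinuousAt (fun q : H × Sph m => D (pair q.1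
        ((dirGauge E h L q.1 q.2)⁻¹ • Matrix.toEuclideanLin L (q.2 : Euc m)))) (x, v) :=
      (hDc.comp continuous_pair).continuousAt.comp' (f := fun q : H × Sph m => (q.1,
        (dirGauge E h L q.1 q.2)⁻¹ • Matrix.toEuclideanLin L (q.2 : Euc m)))
        (continuousAt_fst.prodMk ((hs.inv₀ hpos.ne').smul hLv))
    have hfst : Continuous fun w : Prod2 H m => w.fst := by fun_prop
    have hsnd : Continuous fun w : Prod2 H m => w.snd := by fun_prop
    have hE0 : E (pair x ((dirGauge E h L x v)⁻¹ • Matrix.toEuclideanLin L (v : Euc m))) = h x := by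
      have : levelGauge (fun x z => E (pair x z) - h x) x
          ((dirGauge E h L x v)⁻¹ • Matrix.toEuclideanLin L (v : Euc m)) = 1 := by
        rw [levelGauge_smul _ _ (by positivity)]
        exact inv_mul_cancel₀ hpos.ne'
      exact sub_eq_zero.1 ((hg.levelGauge_eq_one_iff hx).1 this)
    refine ContinuousAt.smul (ContinuousAt.div (hs.pow 2)
      ((hsnd.continuousAt.comp' hz).inner hLv) ?_) ?_
    · exact (inner_snd_pos hsub hg hx (inv_pos.2 hpos) hE0).ne'
    · exact (hfst.continuousAt.comp' hz).sub
        ((continuous_gradient hh).continuousAt.comp' continuousAt_fst)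

end Differentiation

/-! ### Differentiation under the integral over the sphere. -/

section IntegralOverSphere

variable {H : Type*} [NormedAddCommGroup H] [InnerProductSpace ℝ H] [CompleteSpace H] {m : ℕ}
  {E : Prod2 H m → ℝ} {D : Prod2 H m → Prod2 H m} {h : H → ℝ} {k : ℝ}
  {U : Set H} {ε δ M : ℝ} {L : Matrix (Fin m) (Fin m) ℝ} {f : Euc m → ℝ}

theorem continuous_tailGradient_right (hsub : ∀ w y, E w + inner ℝ (D w) (y - w) ≤ E y)
    (hlip : ∀ w y, ‖D w - D y‖ ≤ k * ‖w - y‖) (hk : 0 ≤ k) (hh : ContDiff ℝ 1 h)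
    (hg : SlaterOn (fun x z => E (pair x z) - h x) U ε δ M) (hU : IsOpen U)
    (hm : 1 ≤ m) (hL : L.det ≠ 0) (hf : Continuous f)
    (hgrowth : Tendsto (fun z : Euc m => ‖z‖ ^ (m + 1) * f z) (Bornology.cobounded (Euc m)) (𝓝 0))
    {x : H} (hx : x ∈ U) : Continuous (tailGradient E D h L f x) := by
  have h1 := continuousOn_tailGradient hsub hlip hk hh hg hU hm hL hf hgrowth
  exact h1.comp_continuous (f := fun v : Sph m => (x, v)) (by fun_prop) fun v => ⟨hx, mem_univ v⟩

theorem hasGradientAt_integral_tailMass (hsub : ∀ w y, E w + inner ℝ (D w) (y - w) ≤ E y)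
    (hlip : ∀ w y, ‖D w - D y‖ ≤ k * ‖w - y‖) (hk : 0 ≤ k) (hh : ContDiff ℝ 1 h)
    (hg : SlaterOn (fun x z => E (pair x z) - h x) U ε δ M) (hU : IsOpen U)
    (hm : 1 ≤ m) (hL : L.det ≠ 0) (hf : Continuous f)
    (hgrowth : Tendsto (fun z : Euc m => ‖z‖ ^ (m + 1) * f z) (Bornology.cobounded (Euc m)) (𝓝 0))
    {x : H} (hx : x ∈ U) :
    Integrable (tailGradient E D h L f x) (sphereUnif m) ∧
      HasGradientAt (fun y => ∫ v, tailMass E h L f y v ∂(sphereUnif m))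
        (∫ v, tailGradient E D h L f x v ∂(sphereUnif m)) x := by
  have := isProbabilityMeasure_sphereUnif hm
  have hGc := continuous_tailGradient_right hsub hlip hk hh hg hU hm hL hf hgrowth hx
  have hGi : Integrable (tailGradient E D h L f x) (sphereUnif m) :=
    hGc.integrable_of_hasCompactSupport (HasCompactSupport.of_compactSpace _)
  have hFc : ∀ y ∈ U, Continuous (tailMass E h L f y) := fun y hy =>
    continuous_integral_radialDensity hm hL hf hgrowth (continuous_dirGauge_right hg L hy)
  obtain ⟨K, hK0, hK⟩ := exists_lipschitz_tailMass hg hm hL hf hgrowth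
  have hF'c : Continuous fun v => InnerProductSpace.toDual ℝ H (tailGradient E D h L f x v) :=
    (InnerProductSpace.toDual ℝ H).continuous.comp hGc
  obtain ⟨hint, hder⟩ := hasFDerivAt_integral_of_dominated_loc_of_lip (𝕜 := ℝ)
    (μ := sphereUnif m) (F := tailMass E h L f) (x₀ := x) (s := U) (bound := fun _ => K)
    (F' := fun v => InnerProductSpace.toDual ℝ H (tailGradient E D h L f x v))
    (hU.mem_nhds hx)
    (by filter_upwards [hU.mem_nhds hx] with y hy using (hFc y hy).aestronglyMeasurable)
    ((hFc x hx).integrable_of_hasCompactSupport (HasCompactSupport.of_compactSpace _))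
    hF'c.aestronglyMeasurable
    (ae_of_all _ fun v => LipschitzOnWith.of_dist_le_mul fun y hy z hz => by
      rw [dist_eq_norm, dist_eq_norm, Real.coe_nnabs, abs_of_nonneg hK0]
      exact hK v z hz y hy)
    (integrable_const K)
    (ae_of_all _ fun v =>
      (hasGradientAt_tailMass hsub hlip hh hg hU hm hL hf hgrowth hx v).hasFDerivAt)
  refine ⟨hGi, hasGradientAt_iff_hasFDerivAt.2 (hder.congr_fderiv ?_)⟩
  ext a
  rw [ContinuousLinearMap.integral_apply hint, InnerProductSpace.toDual_apply_apply,
    real_inner_comm, ← integral_inner hGi]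
  refine integral_congr_ae (ae_of_all _ fun v => ?_)
  simp only [InnerProductSpace.toDual_apply_apply]
  exact real_inner_comm _ _

theorem continuousOn_integral_tailGradient (hsub : ∀ w y, E w + inner ℝ (D w) (y - w) ≤ E y)
    (hlip : ∀ w y, ‖D w - D y‖ ≤ k * ‖w - y‖) (hk : 0 ≤ k) (hh : ContDiff ℝ 1 h)
    (hg : SlaterOn (fun x z => E (pair x z) - h x) U ε δ M) (hU : IsOpen U)
    (hm : 1 ≤ m) (hL : L.det ≠ 0) (hf : Continuous f)
    (hgrowth : Tendsto (fun z : Euc m => ‖z‖ ^ (m + 1) * f z)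
      (Bornology.cobounded (Euc m)) (𝓝 0)) :
    ContinuousOn (fun x => ∫ v, tailGradient E D h L f x v ∂(sphereUnif m)) U := by
  have := isProbabilityMeasure_sphereUnif hm
  obtain ⟨K, hK0, hK⟩ := exists_lipschitz_tailMass hg hm hL hf hgrowth
  intro x hx
  have hn := hU.mem_nhds hx
  refine (continuousAt_of_dominated (bound := fun _ => K) ?_ ?_ (integrable_const K)
    (ae_of_all _ fun v => ?_)).continuousWithinAt
  · filter_upwards [hn] with y hy
    exact (continuous_tailGradient_right hsub hlip hk hh hg hU hm hL hf hgrowth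
      hy).aestronglyMeasurable
  · filter_upwards [hn] with y hy
    exact ae_of_all _ fun v => norm_le_of_hasGradientAt
      (hasGradientAt_tailMass hsub hlip hh hg hU hm hL hf hgrowth hy v) (hU.mem_nhds hy) hK0
      fun z hz => hK v y hy z hz
  · have h1 := continuousOn_tailGradient hsub hlip hk hh hg hU hm hL hf hgrowth
    exact (h1.comp (f := fun y : H => (y, v)) (by fun_prop : ContinuousOn _ U)
      fun y hy => ⟨hy, mem_univ v⟩).continuousAt hn

theorem contDiffOn_one_of_hasGradientAt {F : H → ℝ} {G : H → H} (hU : IsOpen U)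
    (hF : ∀ x ∈ U, HasGradientAt F (G x) x) (hG : ContinuousOn G U) : ContDiffOn ℝ 1 F U := by
  rw [← zero_add (1 : WithTop ℕ∞), contDiffOn_succ_iff_fderiv_of_isOpen hU]
  refine ⟨fun x hx => (hF x hx).differentiableAt.differentiableWithinAt, by simp, ?_⟩
  rw [contDiffOn_zero]
  exact ((InnerProductSpace.toDual ℝ H).continuous.comp_continuousOn hG).congr fun x hx =>
    (hF x hx).hasFDerivAt.fderiv

end IntegralOverSphere

/-! ### Identification with the probability function and the mapping G. -/

section Specialization

variable {H : Type*} [NormedAddCommGroup H]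
  {Y : Type*} [NormedAddCommGroup Y] [NormedSpace ℝ Y] {m : ℕ}
  {Φ : H → Euc m → Y} {h : H → ℝ} {C : Set (WeakDual ℝ Y)} {lam : ℝ}
  {U : Set H} {ε δ M : ℝ} {L : Matrix (Fin m) (Fin m) ℝ}
  {f : Euc m → ℝ} {x : H} {v : Sph m}

theorem supEnv_ray_le_iff
    (hg : SlaterOn (fun x z => supEnv Φ h C lam (pair x z) - h x) U ε δ M) (hx : x ∈ U)
    {r : ℝ} (hr : 0 ≤ r) : supEnv Φ h C lam (pair x (ray L r v)) ≤ h x ↔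
      r * dirGauge (supEnv Φ h C lam) h L x v ≤ 1 := by
  rw [dirGauge, ← levelGauge_smul _ _ hr, hg.levelGauge_le_one_iff hx, ← ray, sub_nonpos]

theorem supEnv_ray_eq_iff
    (hg : SlaterOn (fun x z => supEnv Φ h C lam (pair x z) - h x) U ε δ M) (hx : x ∈ U)
    {r : ℝ} (hr : 0 ≤ r) : supEnv Φ h C lam (pair x (ray L r v)) = h x ↔
      r * dirGauge (supEnv Φ h C lam) h L x v = 1 := by
  rw [dirGauge, ← levelGauge_smul _ _ hr, hg.levelGauge_eq_one_iff hx, ← ray, sub_eq_zero]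

theorem mem_finDir_iff
    (hg : SlaterOn (fun x z => supEnv Φ h C lam (pair x z) - h x) U ε δ M) (hx : x ∈ U) :
    v ∈ finDir Φ h C L lam x ↔ 0 < dirGauge (supEnv Φ h C lam) h L x v := by
  constructor
  · rintro ⟨r, hr, hE⟩
    rw [supEnv_ray_eq_iff hg hx hr.le] at hE
    exact pos_of_mul_pos_right (hE ▸ one_pos) hr.le
  · intro hpos
    exact ⟨_, inv_pos.2 hpos,
      (supEnv_ray_eq_iff hg hx (by positivity)).2 (inv_mul_cancel₀ hpos.ne')⟩

theorem rho_toReal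
    (hg : SlaterOn (fun x z => supEnv Φ h C lam (pair x z) - h x) U ε δ M) (hx : x ∈ U)
    (hpos : 0 < dirGauge (supEnv Φ h C lam) h L x v) :
    (rho Φ h C L lam x v).toReal = (dirGauge (supEnv Φ h C lam) h L x v)⁻¹ := by
  have : IsGreatest {s : EReal | ∃ r : ℝ, 0 < r ∧
      supEnv Φ h C lam (pair x (ray L r v)) ≤ h x ∧ s = (r : EReal)}
      (((dirGauge (supEnv Φ h C lam) h L x v)⁻¹ : ℝ) : EReal) := by
    refine ⟨⟨_, inv_pos.2 hpos, ?_, rfl⟩, ?_⟩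
    · rw [supEnv_ray_le_iff hg hx (by positivity), inv_mul_cancel₀ hpos.ne']
    · rintro _ ⟨r, hr, hE, rfl⟩
      rw [supEnv_ray_le_iff hg hx hr.le] at hE
      rw [EReal.coe_le_coe_iff, ← one_div, le_div_iff₀ hpos]
      exact hE
  rw [rho, this.isLUB.sSup_eq, EReal.toReal_coe]

variable {Ω : Type*} [MeasurableSpace Ω] {P : Measure Ω} [IsProbabilityMeasure P] {ξ : Ω → Euc m}

/-- On the complement of the sublevel set the integration runs over 0 < t < gauge, so infinite
directions contribute nothing. -/
theorem regProb_eq (hξ : Measurable ξ)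
    (hdens : P.map ξ = (volume : Measure (Euc m)).withDensity (fun z => ENNReal.ofReal (f z)))
    (hg : SlaterOn (fun x z => supEnv Φ h C lam (pair x z) - h x) U ε δ M)
    (hm : 1 ≤ m) (hL : L.det ≠ 0) (hf : Continuous f) (hf0 : ∀ z, 0 ≤ f z)
    (hgrowth : Tendsto (fun z : Euc m => ‖z‖ ^ (m + 1) * f z)
      (Bornology.cobounded (Euc m)) (𝓝 0)) (hx : x ∈ U) :
    regProb P ξ Φ h C lam x
      = 1 - ∫ v, tailMass (supEnv Φ h C lam) h L f x v ∂(sphereUnif m) := by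
  set B : Set (Euc m) := {z | supEnv Φ h C lam (pair x z) - h x ≤ 0} with hBdef
  have hB : MeasurableSet B := (isClosed_le (hg.continuous x hx) continuous_const).measurableSet
  have hset : {ω | supEnv Φ h C lam (pair x (ξ ω)) ≤ h x} = ξ ⁻¹' B := by
    ext ω
    exact (sub_nonpos (a := supEnv Φ h C lam (pair x (ξ ω))) (b := h x)).symm
  have h1 := withDensity_apply_eq_integral_sphere hm hL hf hf0 hgrowth
    (continuous_dirGauge_right hg L hx) (fun v => dirGauge_nonneg _ _ _ _ v) hB.compl
    fun r hr v => by
      rw [← not_le, ← supEnv_ray_le_iff hg hx hr.le, ← sub_nonpos]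
      rfl
  rw [← hdens, Measure.map_apply hξ hB.compl, preimage_compl] at h1
  have h2 : P.real (ξ ⁻¹' B)ᶜ = ∫ v, tailMass (supEnv Φ h C lam) h L f x v ∂(sphereUnif m) := by
    rw [measureReal_def, h1, ENNReal.toReal_ofReal]
    · rfl
    · exact integral_nonneg fun v => intervalIntegral.integral_nonneg (dirGauge_nonneg _ _ _ _ v)
        fun t _ => radialDensity_nonneg hm hf0 t v
  rw [regProb, hset, ← h2, probReal_compl_eq_one_sub (hξ hB)]
  ring

variable [InnerProductSpace ℝ H] [CompleteSpace H] {D : Prod2 H m → Prod2 H m}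

theorem gradient_fst {E : Prod2 H m → ℝ} {d : Prod2 H m} {z : Euc m}
    (hE : HasGradientAt E d (pair x z)) : gradient (fun y => E (pair y z)) x = d.fst := by
  refine HasGradientAt.gradient (hasGradientAt_iff_hasFDerivAt.2 ?_)
  have h1 : HasFDerivAt (fun y : H => (pair y z : Prod2 H m))
      ((WithLp.prodContinuousLinearEquiv 2 ℝ H (Euc m)).symm.toContinuousLinearMap.comp
        ((ContinuousLinearMap.id ℝ H).prod 0)) x :=
    (WithLp.prodContinuousLinearEquiv 2 ℝ H (Euc m)).symm.hasFDerivAt.comp x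
      ((hasFDerivAt_id x).prodMk (hasFDerivAt_const z x))
  refine (hE.hasFDerivAt.comp x h1).congr_fderiv (ContinuousLinearMap.ext fun a => ?_)
  have : inner ℝ d (pair a 0) = inner ℝ d.fst a := by
    rw [inner_pair, inner_zero_right, add_zero]
  exact this

theorem gradient_snd {E : Prod2 H m → ℝ} {d : Prod2 H m} {z : Euc m}
    (hE : HasGradientAt E d (pair x z)) : gradient (fun y => E (pair x y)) z = d.snd := by
  refine HasGradientAt.gradient (hasGradientAt_iff_hasFDerivAt.2 ?_)
  have h1 : HasFDerivAt (fun y : Euc m => (pair x y : Prod2 H m))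
      ((WithLp.prodContinuousLinearEquiv 2 ℝ H (Euc m)).symm.toContinuousLinearMap.comp
        ((0 : Euc m →L[ℝ] H).prod (ContinuousLinearMap.id ℝ (Euc m)))) z :=
    (WithLp.prodContinuousLinearEquiv 2 ℝ H (Euc m)).symm.hasFDerivAt.comp z
      ((hasFDerivAt_const x z).prodMk (hasFDerivAt_id z))
  refine (hE.hasFDerivAt.comp z h1).congr_fderiv (ContinuousLinearMap.ext fun a => ?_)
  have : inner ℝ d (pair 0 a) = inner ℝ d.snd a := by
    rw [inner_pair, inner_zero_right, zero_add]
  exact this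

/-- On finite directions the 1/t² of the density cancels the s² of the gauge gradient, at t = s =
1/ρ; on infinite directions both sides vanish. -/
theorem gradLike_eq_neg_tailGradient (hgrad : ∀ w, HasGradientAt (supEnv Φ h C lam) (D w) w)
    (hg : SlaterOn (fun x z => supEnv Φ h C lam (pair x z) - h x) U ε δ M) (hx : x ∈ U)
    (v : Sph m) :
    gradLike Φ h C L f lam x v = -tailGradient (supEnv Φ h C lam) D h L f x v := by
  rcases (dirGauge_nonneg (supEnv Φ h C lam) h L x v).eq_or_lt with h0 | hpos
  · rw [gradLike, if_neg (by rw [mem_finDir_iff hg hx, ← h0]; exact lt_irrefl 0), tailGradient,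
      ← h0]
    simp [radialDensity]
  · rw [gradLike, if_pos ((mem_finDir_iff hg hx).2 hpos), rho_toReal hg hx hpos, gradLikeAt,
      gradient_fst (hgrad _), gradient_snd (hgrad _), tailGradient, gaugeGradient, radialDensity,
      if_pos hpos, smul_smul, ← neg_smul, ray]
    congr 1
    field_simp

end Specialization

end ChanceMoreau

end

open ChanceMoreau in
theorem mainTheorem3
    {H : Type*} [NormedAddCommGroup H] [InnerProductSpace ℝ H] [CompleteSpace H]
    [FiniteDimensional ℝ H]
    {Y : Type*} [NormedAddCommGroup Y] [NormedSpace ℝ Y] [CompleteSpace Y]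
    {Ω : Type*} [MeasurableSpace Ω] (P : Measure Ω) [IsProbabilityMeasure P]
    {m : ℕ} (hm : 1 ≤ m)
    -- the random vector and its continuous density
    (ξ : Ω → Euc m) (hξ : Measurable ξ)
    (f : Euc m → ℝ) (hf_cont : Continuous f) (hf_nonneg : ∀ z, 0 ≤ f z)
    (hf_density : P.map ξ = (volume : Measure (Euc m)).withDensity (fun z => ENNReal.ofReal (f z)))
    -- the nonsingular matrix of the spherical-radial decomposition
    (L : Matrix (Fin m) (Fin m) ℝ) (hL : L.det ≠ 0)
    -- the cone and the weak-star compact convex set generating its positive dual cone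
    (K : ConvexCone ℝ Y) (hK : (K : Set Y).Nonempty)
    (C : Set (WeakDual ℝ Y)) (hC_compact : IsCompact C) (hC_convex : Convex ℝ C)
    (hC_gen : closure (coneOf C) = posDual (K : Set Y))
    -- the constraint mapping and the convexifying function
    (Φ : H → Euc m → Y) (h : H → ℝ) (hh_smooth : ContDiff ℝ 1 h) (hh_convex : ConvexOn ℝ univ h)
    (hΦ_convex : ∀ v ∈ C, ConvexOn ℝ univ (scal Φ h v))
    (xbar : H) (hxbar : supFun Φ h C (pair xbar 0) < h xbar)
    (hf_growth : Tendsto (fun z : Euc m => ‖z‖ ^ (m + 1) * f z) (Bornology.cobounded (Euc m)) (𝓝 0))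
    (lam : ℝ) (hlam : 0 < lam) :
    (∃ U : Set H, IsOpen U ∧ xbar ∈ U ∧
      (∀ x ∈ U, supEnv Φ h C lam (pair x 0) < h x) ∧
      ContDiffOn ℝ 1 (regProb P ξ Φ h C lam) U ∧
      ∀ x ∈ U,
        Integrable (fun v => gradLike Φ h C L f lam x v) (sphereUnif m) ∧
        HasGradientAt (regProb P ξ Φ h C lam)
          (∫ v, gradLike Φ h C L f lam x v ∂(sphereUnif m)) x) ∧
    (∀ (x : H) (z : Euc m),
      (∃ v ∈ C, moreau lam (scal Φ h v) (pair x z) = supEnv Φ h C lam (pair x z)) ∧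
      ∀ v ∈ C, moreau lam (scal Φ h v) (pair x z) = supEnv Φ h C lam (pair x z) →
        ∃ p : Prod2 H m, proxSet lam (scal Φ h v) (pair x z) = {p} ∧
          HasGradientAt (supEnv Φ h C lam) (lam⁻¹ • (pair x z - p)) (pair x z)) := by
  have hne := nonempty_of_closure_coneOf hC_gen
  obtain ⟨p, hp, hsub, hlip⟩ := exists_gradient_supEnv hC_compact hne hΦ_convex hlam
  have hgrad := fun w => hasGradientAt_of_subgradient_lipschitz hsub hlip w
  have hk : 0 ≤ lam⁻¹ := by positivity
  refine ⟨?_, fun x z => ⟨exists_active hC_compact hC_convex hne hΦ_convex hlam _,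
    fun v hv hact => ⟨p (pair x z), ?_, hgrad (pair x z)⟩⟩⟩
  -- The envelope lies below S, so the Slater condition at x̄ passes from S to E.
  · obtain ⟨ε, δ, M, hg⟩ := exists_slaterOn hk hsub hlip hh_smooth
      ((moreau_le_self (hp (pair xbar 0))).trans_lt hxbar)
    have hU : IsOpen (Metric.ball xbar ε) := Metric.isOpen_ball
    have hG : ∀ x ∈ Metric.ball xbar ε, (fun v => gradLike Φ h C L f lam x v)
        = -tailGradient (supEnv Φ h C lam) (fun w => lam⁻¹ • (w - p w)) h L f x :=
      fun x hx => funext fun v => gradLike_eq_neg_tailGradient hgrad hg hx v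
    have hmain := fun x (hx : x ∈ Metric.ball xbar ε) =>
      hasGradientAt_integral_tailMass hsub hlip hk hh_smooth hg hU hm hL hf_cont hf_growth hx
    have hder : ∀ x ∈ Metric.ball xbar ε, HasGradientAt (regProb P ξ Φ h C lam)
        (∫ v, gradLike Φ h C L f lam x v ∂(sphereUnif m)) x := by
      intro x hx
      have h1 := ((hmain x hx).2.hasFDerivAt).const_sub 1
      rw [hG x hx, integral_neg', hasGradientAt_iff_hasFDerivAt, map_neg]
      refine h1.congr_of_eventuallyEq ?_
      filter_upwards [hU.mem_nhds hx] with y hy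
      exact regProb_eq hξ hf_density hg hm hL hf_cont hf_nonneg hf_growth hy
    refine ⟨Metric.ball xbar ε, hU, Metric.mem_ball_self hg.radius_pos, fun x hx => ?_, ?_,
      fun x hx => ⟨?_, hder x hx⟩⟩
    · linarith [hg.slack x hx, hg.slack_pos]
    · refine contDiffOn_one_of_hasGradientAt hU hder ?_
      refine (continuousOn_integral_tailGradient hsub hlip hk hh_smooth hg hU hm hL hf_cont
        hf_growth).neg.congr fun x hx => ?_
      rw [hG x hx, integral_neg']
      rfl
    · rw [hG x hx]
      exact (hmain x hx).1.neg
  · exact proxSet_scal_of_active hC_compact hv (hΦ_convex v hv) hlam (hp _) hact
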